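/- Let $A$ and $B$ be finite-dimensional quantum systems, each with a fixed orthonormal "incoherent" basis; groups of several systems held by one party carry the product basis. An incoherent operation from a system $X$ to a system $Y$ is a finite family of Kraus operators $K_i\colon X\to Y$ with $\sum_i K_i^\dagger K_i=\mathbb I$ such that $K_i\rho K_i^\dagger$ is diagonal in the incoherent basis of $Y$ for every $i$ and every density matrix $\rho$ that is diagonal in the incoherent basis of $X$. An LIOCC map is a map realised by a protocol of finitely many rounds, in each of which Alice or Bob performs an incoherent operation on their own system and announces the outcome, all later operations being allowed to depend on the outcomes announced so far; at the end the outcomes are forgotten (summed over). A unit vector $\Lambda_d$ of a finite-dimensional bipartite system is a $d\otimes d$ maximally entangled state if its two reduced states are $\frac1d P$ and $\frac1d Q$, where $P$ and $Q$ are orthogonal projections of rank $d$ (the identities of $d$-dimensional local subspaces, whose position relative to the incoherent bases is arbitrary). Let $|\Psi\rangle\in A\otimes B$ be a unit vector. A real number $R$ is an achievable LIOCC entanglement distillation rate for $\Psi$ if for every $\epsilon>0$ there are an integer $n\ge1$, an LIOCC map $\mathcal L$ acting on $\Psi^{\otimes n}$, and a $d\otimes d$ maximally entangled state $\Lambda_d$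 of the output system with $$\tfrac12\big\|\mathcal L(\Psi^{\otimes n})-\Lambda_d\big\|_1\le\epsilon\qquad\text{and}\qquad \tfrac1n\log_2 d>R-\epsilon .$$ Theorem. There is a largest achievable LIOCC entanglement distillation rate $E_D^{LIOCC}(\Psi)$, and $$E_D^{LIOCC}(\Psi)=\mathrm E(\Psi):=-\operatorname{tr}\big[\Psi^A\log_2\Psi^A\big],$$ where $\Psi^A=\operatorname{tr}_B|\Psi\rangle\langle\Psi|$. -/

import Mathlib

open scoped Kronecker Matrix ComplexOrder

noncomputable section

namespace Liocc

/-- The vector `ψ`, given by its coefficients in an orthonormal basis indexed by `X`, is a unit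
vector, i.e. a pure state. -/
def IsPureState {X : Type} [Fintype X] (ψ : X → ℂ) : Prop :=
  ∑ x, ‖ψ x‖ ^ 2 = 1

/-- The density matrix `|ψ⟩⟨ψ|`. -/
def density {X : Type} (ψ : X → ℂ) : Matrix X X ℂ :=
  Matrix.vecMulVec ψ (star ψ)

/-- The partial trace over Bob's system. -/
def reducedA {A B : Type} [Fintype B] (ρ : Matrix (A × B) (A × B) ℂ) : Matrix A A ℂ :=
  Matrix.of fun a a' => ∑ b, ρ (a, b) (a', b)

/-- The partial trace over Alice's system. -/
def reducedB {A B : Type} [Fintype A] (ρ : Matrix (A × B) (A × B) ℂ) : Matrix B B ℂ :=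
  Matrix.of fun b b' => ∑ a, ρ (a, b) (a, b')

/-- The state `Ψ^{⊗ n}`, with Alice's `n` copies and Bob's `n` copies grouped together. The
incoherent bases of the two groups are the product bases. -/
def copies {A B : Type} (n : ℕ) (Ψ : A × B → ℂ) : (Fin n → A) × (Fin n → B) → ℂ :=
  fun p => ∏ i, Ψ (p.1 i, p.2 i)

theorem density_isHermitian {X : Type} (ψ : X → ℂ) : (density ψ).IsHermitian := by
  ext i j
  simp [density, Matrix.vecMulVec_apply, mul_comm]

theorem reducedA_isHermitian {A B : Type} [Fintype B] {ρ : Matrix (A × B) (A × B) ℂ}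
    (h : ρ.IsHermitian) : (reducedA ρ).IsHermitian := by
  ext a a'
  simp only [reducedA, Matrix.conjTranspose_apply, Matrix.of_apply, star_sum]
  exact Finset.sum_congr rfl fun b _ => h.apply (a, b) (a', b)

/-- The von Neumann entropy `-tr (ρ log₂ ρ)` (with `0 log 0 = 0`). -/
def vonNeumannEntropy {X : Type} [Fintype X] [DecidableEq X] {ρ : Matrix X X ℂ}
    (h : ρ.IsHermitian) : ℝ :=
  -∑ i, h.eigenvalues i * Real.logb 2 (h.eigenvalues i)

/-- The entropy of entanglement of a bipartite pure state: the von Neumann entropy of Alice's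
reduced state. -/
def entanglementEntropy {A B : Type} [Fintype A] [DecidableEq A] [Fintype B]
    (Ψ : A × B → ℂ) : ℝ :=
  vonNeumannEntropy (reducedA_isHermitian (density_isHermitian Ψ))

/-- The trace norm `tr √(Mᴴ M)`. -/
def traceNorm {X : Type} [Fintype X] [DecidableEq X] (M : Matrix X X ℂ) : ℝ :=
  ∑ i, √((Matrix.isHermitian_conjTranspose_mul_self M).eigenvalues i)

/-- The trace distance `½ ‖ρ - σ‖₁`. -/
def traceDistance {X : Type} [Fintype X] [DecidableEq X] (ρ σ : Matrix X X ℂ) : ℝ :=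
  traceNorm (ρ - σ) / 2

/-- The incoherent states: density matrices that are diagonal in the incoherent basis, which is
always the basis that indexes the matrices. -/
def IsIncoherentState {X : Type} [Fintype X] (ρ : Matrix X X ℂ) : Prop :=
  ρ.PosSemidef ∧ ρ.trace = 1 ∧ ρ.IsDiag

/-- An incoherent operation from a system with incoherent basis `X` to a system with incoherent
basis `Y`: a complete finite family of Kraus operators, each of which sends every incoherent state
to a multiple of an incoherent state (a positive semidefinite matrix is such a multiple exactly
when it is diagonal). The input and output systems may differ, so that ancillas in incoherent
states can be added and subsystems can be discarded. -/
def IsIncoherentOperation {X Y ι : Type} [Fintype X] [DecidableEq X] [Fintype Y] [Fintype ι]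
    (K : ι → Matrix Y X ℂ) : Prop :=
  (∑ i, (K i)ᴴ * K i = 1) ∧
    ∀ i, ∀ ρ : Matrix X X ℂ, IsIncoherentState ρ → (K i * ρ * (K i)ᴴ).IsDiag

/-- The LIOCC maps from a bipartite system `A`, `B` to a bipartite system `A'`, `B'`: the maps
realised by protocols with finitely many rounds. Either nothing is done, or one of the parties
performs an incoherent operation and broadcasts its outcome `i`, after which the parties continue
with an LIOCC protocol that may depend on `i`. The classical record is forgotten at the end, so
the output is the sum over all outcomes. -/
inductive IsLIOCC {A' B' : Type} [Fintype A'] [DecidableEq A'] [Fintype B'] [DecidableEq B'] :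
    ∀ {A B : Type} [Fintype A] [DecidableEq A] [Fintype B] [DecidableEq B],
      (Matrix (A × B) (A × B) ℂ → Matrix (A' × B') (A' × B') ℂ) → Prop
  | done : IsLIOCC (A := A') (B := B') (fun ρ => ρ)
  | alice {A B A₁ ι : Type} [Fintype A] [DecidableEq A] [Fintype B] [DecidableEq B]
      [Fintype A₁] [DecidableEq A₁] [Fintype ι]
      (K : ι → Matrix A₁ A ℂ) (hK : IsIncoherentOperation K)
      (N : ι → Matrix (A₁ × B) (A₁ × B) ℂ → Matrix (A' × B') (A' × B') ℂ)
      (hN : ∀ i, IsLIOCC (N i)) :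
      IsLIOCC (A := A) (B := B) fun ρ =>
        ∑ i, N i ((K i ⊗ₖ (1 : Matrix B B ℂ)) * ρ * (K i ⊗ₖ (1 : Matrix B B ℂ))ᴴ)
  | bob {A B B₁ ι : Type} [Fintype A] [DecidableEq A] [Fintype B] [DecidableEq B]
      [Fintype B₁] [DecidableEq B₁] [Fintype ι]
      (K : ι → Matrix B₁ B ℂ) (hK : IsIncoherentOperation K)
      (N : ι → Matrix (A × B₁) (A × B₁) ℂ → Matrix (A' × B') (A' × B') ℂ)
      (hN : ∀ i, IsLIOCC (N i)) :
      IsLIOCC (A := A) (B := B) fun ρ =>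
        ∑ i, N i (((1 : Matrix A A ℂ) ⊗ₖ K i) * ρ * ((1 : Matrix A A ℂ) ⊗ₖ K i)ᴴ)

/-- A `d ⊗ d` maximally entangled pure state: both reduced states are `1/d` times the identity of
a `d`-dimensional local subspace. The subspaces, and hence the Schmidt bases, are arbitrary with
respect to the incoherent bases. (Since the state is normalised, `d ≠ 0`.) -/
def IsMaximallyEntangled {A B : Type} [Fintype A] [DecidableEq A] [Fintype B] [DecidableEq B]
    (d : ℕ) (φ : A × B → ℂ) : Prop :=
  IsPureState φ ∧
    ∃ (P : Matrix A A ℂ) (Q : Matrix B B ℂ),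
      IsStarProjection P ∧ P.rank = d ∧ IsStarProjection Q ∧ Q.rank = d ∧
        reducedA (density φ) = (d : ℂ)⁻¹ • P ∧ reducedB (density φ) = (d : ℂ)⁻¹ • Q

/-- `R` is an achievable LIOCC entanglement distillation rate for `Ψ`. -/
def IsAchievableRate {A B : Type} [Fintype A] [DecidableEq A] [Fintype B] [DecidableEq B]
    (Ψ : A × B → ℂ) (R : ℝ) : Prop :=
  ∀ ε : ℝ, 0 < ε → ∃ n : ℕ, 0 < n ∧ ∃ (a b : ℕ)
    (L : Matrix ((Fin n → A) × (Fin n → B)) ((Fin n → A) × (Fin n → B)) ℂ →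
      Matrix (Fin a × Fin b) (Fin a × Fin b) ℂ)
    (d : ℕ) (Λ : Fin a × Fin b → ℂ),
    IsLIOCC L ∧ IsMaximallyEntangled d Λ ∧
      traceDistance (L (density (copies n Ψ))) (density Λ) ≤ ε ∧
      1 / (n : ℝ) * Real.logb 2 d > R - ε

end Liocc

end

namespace Liocc

/-! ### The trace norm -/

/-- The Euclidean norm of a vector of coefficients. -/
noncomputable def vecNorm {X : Type} [Fintype X] (x : X → ℂ) : ℝ := ‖WithLp.toLp 2 x‖

theorem vecNorm_sq {X : Type} [Fintype X] (x : X → ℂ) : vecNorm x ^ 2 = ∑ i, ‖x i‖ ^ 2 := by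
  rw [vecNorm, EuclideanSpace.norm_sq_eq]

theorem vecNorm_nonneg {X : Type} [Fintype X] (x : X → ℂ) : 0 ≤ vecNorm x := norm_nonneg _

theorem vecNorm_smul {X : Type} [Fintype X] (c : ℂ) (x : X → ℂ) :
    vecNorm (c • x) = ‖c‖ * vecNorm x := by
  rw [vecNorm, vecNorm, WithLp.toLp_smul, norm_smul]

theorem IsPureState.vecNorm_eq {X : Type} [Fintype X] {x : X → ℂ} (h : IsPureState x) :
    vecNorm x = 1 := by
  have h1 : vecNorm x ^ 2 = 1 := by rw [vecNorm_sq]; exact h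
  nlinarith [vecNorm_nonneg x]

theorem norm_dotProduct_le {X : Type} [Fintype X] (x y : X → ℂ) :
    ‖star x ⬝ᵥ y‖ ≤ vecNorm x * vecNorm y := by
  have := norm_inner_le_norm (𝕜 := ℂ) (WithLp.toLp 2 x) (WithLp.toLp 2 y)
  rwa [EuclideanSpace.inner_toLp_toLp, dotProduct_comm] at this

theorem star_dotProduct_self {X : Type} [Fintype X] (x : X → ℂ) :
    star x ⬝ᵥ x = ((vecNorm x ^ 2 : ℝ) : ℂ) := by
  rw [vecNorm_sq, dotProduct]
  push_cast
  exact Finset.sum_congr rfl fun i _ => by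
    rw [Pi.star_apply, Complex.star_def, Complex.conj_mul']

theorem inner_mulVec_eigenvectorBasis {X : Type} [Fintype X] [DecidableEq X] (M : Matrix X X ℂ)
    (i j : X) :
    inner ℂ
      (WithLp.toLp 2
        (M *ᵥ ((Matrix.isHermitian_conjTranspose_mul_self M).eigenvectorBasis i).ofLp))
      (WithLp.toLp 2
        (M *ᵥ ((Matrix.isHermitian_conjTranspose_mul_self M).eigenvectorBasis j).ofLp)) =
    if i = j then (((Matrix.isHermitian_conjTranspose_mul_self M).eigenvalues j : ℝ) : ℂ) else 0 := by
  set h := Matrix.isHermitian_conjTranspose_mul_self M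
  rw [EuclideanSpace.inner_toLp_toLp, Matrix.star_mulVec, dotProduct_comm,
    ← Matrix.dotProduct_mulVec, Matrix.mulVec_mulVec, h.mulVec_eigenvectorBasis, dotProduct_smul]
  have := orthonormal_iff_ite.mp h.eigenvectorBasis.orthonormal i j
  rw [EuclideanSpace.inner_eq_star_dotProduct, dotProduct_comm] at this
  rw [this]
  split_ifs <;> simp

theorem eigenvalues_conjTranspose_mul_self_nonneg {X : Type} [Fintype X] [DecidableEq X]
    (M : Matrix X X ℂ) (i : X) : 0 ≤ (Matrix.isHermitian_conjTranspose_mul_self M).eigenvalues i :=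
  (Matrix.posSemidef_conjTranspose_mul_self M).eigenvalues_nonneg i

/-- The trace norm of a sum of rank-one matrices is at most the sum of the products of norms. -/
theorem traceNorm_sum_vecMulVec_le {X κ : Type} [Fintype X] [DecidableEq X] [Fintype κ]
    (x y : κ → X → ℂ) :
    traceNorm (∑ k, Matrix.vecMulVec (x k) (star (y k))) ≤ ∑ k, vecNorm (x k) * vecNorm (y k) := by
  set M := ∑ k, Matrix.vecMulVec (x k) (star (y k)) with hM
  set h := Matrix.isHermitian_conjTranspose_mul_self M
  set v := h.eigenvectorBasis
  set σ := h.eigenvalues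
  have hσ : ∀ i, 0 ≤ σ i := eigenvalues_conjTranspose_mul_self_nonneg M
  let w : X → EuclideanSpace ℂ X := fun i => WithLp.toLp 2 (M *ᵥ (v i).ofLp)
  have hw : ∀ i j, inner ℂ (w i) (w j) = if i = j then ((σ j : ℝ) : ℂ) else 0 :=
    inner_mulVec_eigenvectorBasis M
  let S := {i : X // σ i ≠ 0}
  let u : S → EuclideanSpace ℂ X := fun i => ((√(σ i))⁻¹ : ℂ) • w i
  have hu : Orthonormal ℂ u := by
    rw [orthonormal_iff_ite]
    intro i j
    simp only [u, inner_smul_left, inner_smul_right, hw]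
    by_cases hij : i = j
    · rw [hij, if_pos rfl, if_pos rfl]
      have h0 : (√(σ j) : ℂ) ≠ 0 := by
        exact_mod_cast (Real.sqrt_ne_zero (hσ j)).mpr j.2
      have h1 : ((σ j : ℝ) : ℂ) = (√(σ j) : ℂ) * (√(σ j) : ℂ) := by
        exact_mod_cast (Real.mul_self_sqrt (hσ j)).symm
      rw [h1]
      simp only [map_inv₀, Complex.conj_ofReal]
      field_simp
    · rw [if_neg hij, if_neg fun h => hij (Subtype.ext h)]
      simp
  have hv : Orthonormal ℂ (fun i : S => v i) :=
    v.orthonormal.comp _ Subtype.val_injective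
  have key : ∀ i : S, √(σ i) ≤ ∑ k, ‖inner ℂ (u i) (WithLp.toLp 2 (x k))‖ *
      ‖inner ℂ (v i) (WithLp.toLp 2 (y k))‖ := by
    intro i
    have e1 : inner ℂ (u i) (w i) = (√(σ i) : ℂ) := by
      simp only [u, inner_smul_left, hw, if_true, map_inv₀, Complex.conj_ofReal]
      have h0 : (√(σ i) : ℂ) ≠ 0 := by
        exact_mod_cast (Real.sqrt_ne_zero (hσ i)).mpr i.2
      have h1 : ((σ i : ℝ) : ℂ) = (√(σ i) : ℂ) * (√(σ i) : ℂ) := by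
        exact_mod_cast (Real.mul_self_sqrt (hσ i)).symm
      rw [h1]; field_simp
    have e2 : w i = ∑ k, inner ℂ (WithLp.toLp 2 (y k)) (v i) • WithLp.toLp 2 (x k) := by
      have : M *ᵥ (v i).ofLp = ∑ k, (star (y k) ⬝ᵥ (v i).ofLp) • x k := by
        rw [hM, Matrix.sum_mulVec]
        exact Finset.sum_congr rfl fun k _ => by
          rw [Matrix.vecMulVec_mulVec]; ext a; simp [mul_comm]
      simp only [w]
      rw [this, WithLp.toLp_sum]
      refine Finset.sum_congr rfl fun k _ => ?_
      rw [WithLp.toLp_smul, EuclideanSpace.inner_eq_star_dotProduct, dotProduct_comm]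
    have e3 : √(σ i) = ‖inner ℂ (u i) (w i)‖ := by
      rw [e1, Complex.norm_real, Real.norm_of_nonneg (Real.sqrt_nonneg _)]
    rw [e3, e2, inner_sum]
    refine (norm_sum_le _ _).trans (Finset.sum_le_sum fun k _ => ?_)
    rw [inner_smul_right, norm_mul, norm_inner_symm, mul_comm]
  have e4 : traceNorm M = ∑ i : S, √(σ i) := by
    rw [traceNorm, ← Finset.sum_subtype (Finset.univ.filter fun i => σ i ≠ 0) (by simp)
      fun i => √(σ i), Finset.sum_filter]
    refine Finset.sum_congr rfl fun i _ => ?_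
    split_ifs with hi
    · rfl
    · change √(σ i) = 0
      rw [not_not.mp hi, Real.sqrt_zero]
  rw [e4]
  refine (Finset.sum_le_sum fun i _ => key i).trans ?_
  rw [Finset.sum_comm]
  refine Finset.sum_le_sum fun k _ => ?_
  refine (Real.sum_mul_le_sqrt_mul_sqrt _ _ _).trans ?_
  refine mul_le_mul ?_ ?_ (Real.sqrt_nonneg _) (vecNorm_nonneg _)
  · exact Real.sqrt_le_iff.mpr ⟨vecNorm_nonneg _, hu.sum_inner_products_le _⟩
  · exact Real.sqrt_le_iff.mpr ⟨vecNorm_nonneg _, hv.sum_inner_products_le _⟩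

theorem vecNorm_mulVec_le {X : Type} [Fintype X] [DecidableEq X] (M : Matrix X X ℂ) (u : X → ℂ) :
    vecNorm (M *ᵥ u) ≤ traceNorm M * vecNorm u := by
  set h := Matrix.isHermitian_conjTranspose_mul_self M
  set v := h.eigenvectorBasis
  set σ := h.eigenvalues
  have hσ : ∀ i, 0 ≤ σ i := eigenvalues_conjTranspose_mul_self_nonneg M
  have hw : ∀ i j, inner ℂ (WithLp.toLp 2 (M *ᵥ (v i).ofLp)) (WithLp.toLp 2 (M *ᵥ (v j).ofLp)) =
      if i = j then ((σ j : ℝ) : ℂ) else 0 := inner_mulVec_eigenvectorBasis M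
  have hn : ∀ i, vecNorm (M *ᵥ (v i).ofLp) = √(σ i) := by
    intro i
    have := hw i i
    rw [if_pos rfl, inner_self_eq_norm_sq_to_K] at this
    have h2 : vecNorm (M *ᵥ (v i).ofLp) ^ 2 = σ i := Complex.ofReal_injective (by
      rw [← this, vecNorm]; simp)
    rw [← h2, Real.sqrt_sq (vecNorm_nonneg _)]
  have hu : WithLp.toLp 2 u = ∑ i, inner ℂ (v i) (WithLp.toLp 2 u) • v i := (v.sum_repr' _).symm
  have hu' : u = ∑ i, inner ℂ (v i) (WithLp.toLp 2 u) • (v i).ofLp := by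
    have := congrArg WithLp.ofLp hu
    rwa [WithLp.ofLp_sum] at this
  have e1 : WithLp.toLp 2 (M *ᵥ u) =
      ∑ i, inner ℂ (v i) (WithLp.toLp 2 u) • WithLp.toLp 2 (M *ᵥ (v i).ofLp) := by
    conv_lhs => rw [hu']
    rw [Matrix.mulVec_sum, WithLp.toLp_sum]
    exact Finset.sum_congr rfl fun i _ => by rw [Matrix.mulVec_smul, WithLp.toLp_smul]
  rw [vecNorm, e1, traceNorm, Finset.sum_mul]
  refine (norm_sum_le _ _).trans (Finset.sum_le_sum fun i _ => ?_)
  rw [norm_smul, mul_comm]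
  refine mul_le_mul (hn i).le ?_ (norm_nonneg _) (Real.sqrt_nonneg _)
  have := norm_inner_le_norm (𝕜 := ℂ) (v i) (WithLp.toLp 2 u)
  rwa [v.norm_eq_one, one_mul] at this

/-! ### Tensor powers of matrices -/

/-- The `n`-th tensor power of a matrix. -/
def tensorPower {X Y : Type} (n : ℕ) (M : Matrix X Y ℂ) : Matrix (Fin n → X) (Fin n → Y) ℂ :=
  Matrix.of fun u w => ∏ i, M (u i) (w i)

theorem tensorPower_mul {X Y Z : Type} [Fintype Y] (n : ℕ) (M : Matrix X Y ℂ) (N : Matrix Y Z ℂ) :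
    tensorPower n (M * N) = tensorPower n M * tensorPower n N := by
  ext u w
  simp only [tensorPower, Matrix.of_apply, Matrix.mul_apply, Fintype.prod_sum,
    Finset.prod_mul_distrib]

theorem tensorPower_conjTranspose {X Y : Type} (n : ℕ) (M : Matrix X Y ℂ) :
    tensorPower n Mᴴ = (tensorPower n M)ᴴ := by
  ext u w
  simp [tensorPower, Matrix.conjTranspose_apply]

theorem tensorPower_diagonal {X : Type} [DecidableEq X] (n : ℕ) (d : X → ℂ) :
    tensorPower n (Matrix.diagonal d) = Matrix.diagonal fun w : Fin n → X => ∏ i, d (w i) := by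
  ext u w
  simp only [tensorPower, Matrix.of_apply]
  by_cases h : u = w
  · subst h; simp
  · rw [Matrix.diagonal_apply_ne _ h]
    obtain ⟨i, hi⟩ := Function.ne_iff.mp h
    exact Finset.prod_eq_zero (Finset.mem_univ i) (Matrix.diagonal_apply_ne _ hi)

theorem tensorPower_one {X : Type} [DecidableEq X] (n : ℕ) :
    tensorPower n (1 : Matrix X X ℂ) = 1 := by
  rw [← Matrix.diagonal_one, tensorPower_diagonal]
  simp

/-! ### The weak law of large numbers for words -/

theorem sum_prod_word {Y : Type} [Fintype Y] (p : Y → ℝ) (n : ℕ) :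
    ∑ w : Fin n → Y, ∏ i, p (w i) = (∑ y, p y) ^ n := by
  rw [← Fintype.prod_sum fun (_ : Fin n) y => p y]
  simp

theorem sum_word_succ {Y : Type} [Fintype Y] (n : ℕ) (F : (Fin (n + 1) → Y) → ℝ) :
    ∑ w, F w = ∑ y, ∑ w, F (Fin.cons y w) := by
  rw [← (Fin.consEquiv fun _ => Y).sum_comp, Fintype.sum_prod_type]
  rfl

theorem sum_word_mean_zero {Y : Type} [Fintype Y] {p g : Y → ℝ} (hp : ∑ y, p y = 1)
    (hg : ∑ y, p y * g y = 0) (n : ℕ) :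
    ∑ w : Fin n → Y, (∏ i, p (w i)) * ∑ i, g (w i) = 0 := by
  induction n with
  | zero => simp
  | succ n ih =>
    rw [sum_word_succ]
    simp only [Fin.prod_univ_succ, Fin.sum_univ_succ, Fin.cons_zero, Fin.cons_succ]
    have : ∀ y, ∑ w : Fin n → Y, (p y * ∏ i, p (w i)) * (g y + ∑ i, g (w i)) =
        p y * g y := by
      intro y
      have h1 := sum_prod_word p n
      rw [hp, one_pow] at h1
      calc _ = p y * g y * ∑ w : Fin n → Y, ∏ i, p (w i) +
            p y * ∑ w : Fin n → Y, (∏ i, p (w i)) * ∑ i, g (w i) := by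
            rw [Finset.mul_sum, Finset.mul_sum, ← Finset.sum_add_distrib]
            exact Finset.sum_congr rfl fun w _ => by ring
        _ = _ := by rw [h1, ih]; ring
    simp only [this, hg]

theorem sum_word_second_moment {Y : Type} [Fintype Y] {p g : Y → ℝ} (hp : ∑ y, p y = 1)
    (hg : ∑ y, p y * g y = 0) (n : ℕ) :
    ∑ w : Fin n → Y, (∏ i, p (w i)) * (∑ i, g (w i)) ^ 2 = n * ∑ y, p y * g y ^ 2 := by
  induction n with
  | zero => simp
  | succ n ih =>
    rw [sum_word_succ]
    simp only [Fin.prod_univ_succ, Fin.sum_univ_succ, Fin.cons_zero, Fin.cons_succ]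
    have h1 := sum_prod_word p n
    rw [hp, one_pow] at h1
    have h2 := sum_word_mean_zero hp hg n
    have : ∀ y, ∑ w : Fin n → Y, (p y * ∏ i, p (w i)) * (g y + ∑ i, g (w i)) ^ 2 =
        p y * g y ^ 2 + p y * (n * ∑ y, p y * g y ^ 2) := by
      intro y
      calc _ = p y * g y ^ 2 * ∑ w : Fin n → Y, ∏ i, p (w i) +
            2 * p y * g y * ∑ w : Fin n → Y, (∏ i, p (w i)) * ∑ i, g (w i) +
            p y * ∑ w : Fin n → Y, (∏ i, p (w i)) * (∑ i, g (w i)) ^ 2 := by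
            rw [Finset.mul_sum, Finset.mul_sum, Finset.mul_sum, ← Finset.sum_add_distrib,
              ← Finset.sum_add_distrib]
            exact Finset.sum_congr rfl fun w _ => by ring
        _ = _ := by rw [h1, h2, ih]; ring
    simp only [this, Finset.sum_add_distrib, ← Finset.sum_mul, hp]
    push_cast; ring

/-- Chebyshev's inequality for the empirical mean of `f` over a random word. -/
theorem sum_word_deviation_le {Y : Type} [Fintype Y] {p : Y → ℝ} (f : Y → ℝ) (hp0 : ∀ y, 0 ≤ p y)
    (hp : ∑ y, p y = 1) {n : ℕ} (hn : 0 < n) {δ : ℝ} (hδ : 0 < δ) (s : Finset (Fin n → Y))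
    (hs : ∀ w ∈ s, n * δ ≤ |∑ i, f (w i) - n * ∑ y, p y * f y|) :
    ∑ w ∈ s, ∏ i, p (w i) ≤ (∑ y, p y * (f y - ∑ y, p y * f y) ^ 2) / δ ^ 2 / n := by
  set μ := ∑ y, p y * f y
  have hg : ∑ y, p y * (f y - μ) = 0 := by
    simp only [mul_sub, Finset.sum_sub_distrib, ← Finset.sum_mul, hp]
    ring
  have hnpos : (0 : ℝ) < n := by exact_mod_cast hn
  have h := sum_word_second_moment hp hg n
  have h1 : ∑ w ∈ s, (∏ i, p (w i)) * (n * δ) ^ 2 ≤ n * ∑ y, p y * (f y - μ) ^ 2 := by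
    rw [← h]
    refine (Finset.sum_le_sum fun w hw => ?_).trans
      (Finset.sum_le_univ_sum_of_nonneg fun w =>
        mul_nonneg (Finset.prod_nonneg fun i _ => hp0 _) (sq_nonneg _))
    refine mul_le_mul_of_nonneg_left ?_ (Finset.prod_nonneg fun i _ => hp0 _)
    rw [← sq_abs (∑ i, (f (w i) - μ))]
    have e : ∑ i, (f (w i) - μ) = ∑ i, f (w i) - n * μ := by simp
    rw [e]
    exact pow_le_pow_left₀ (by positivity) (hs w hw) 2
  rw [← Finset.sum_mul] at h1
  rw [div_div, le_div_iff₀ (by positivity)]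
  have h2 : (n : ℝ) * ((∑ w ∈ s, ∏ i, p (w i)) * (δ ^ 2 * n)) ≤
      n * ∑ y, p y * (f y - μ) ^ 2 := by
    refine le_trans (le_of_eq ?_) h1
    ring
  exact le_of_mul_le_mul_left h2 hnpos

/-! ### Kraus decompositions of LIOCC maps -/

/-- An LIOCC map has a Kraus decomposition into product operators. -/
theorem IsLIOCC.exists_kraus {A' B' : Type} [Fintype A'] [DecidableEq A'] [Fintype B']
    [DecidableEq B'] {A B : Type} [Fintype A] [DecidableEq A] [Fintype B] [DecidableEq B]
    {L : Matrix (A × B) (A × B) ℂ → Matrix (A' × B') (A' × B') ℂ} (hL : IsLIOCC L) :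
    ∃ (κ : Type) (_ : Fintype κ) (M : κ → Matrix A' A ℂ) (N : κ → Matrix B' B ℂ),
      (∀ ρ, L ρ = ∑ k, (M k ⊗ₖ N k) * ρ * (M k ⊗ₖ N k)ᴴ) ∧
        ∑ k, (M k ⊗ₖ N k)ᴴ * (M k ⊗ₖ N k) = 1 := by
  induction hL with
  | done =>
    exact ⟨Unit, inferInstance, fun _ => 1, fun _ => 1, by simp, by simp⟩
  | @alice A B A₁ ι _ _ _ _ _ _ _ K hK N hN ih =>
    choose κ hκ M' N' h1 h2 using ih
    refine ⟨Σ i, κ i, inferInstance, fun k => M' k.1 k.2 * K k.1, fun k => N' k.1 k.2, ?_, ?_⟩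
    · intro ρ
      rw [Fintype.sum_sigma]
      refine Finset.sum_congr rfl fun i _ => ?_
      rw [h1]
      refine Finset.sum_congr rfl fun k _ => ?_
      have : (M' i k * K i) ⊗ₖ N' i k = (M' i k ⊗ₖ N' i k) * (K i ⊗ₖ (1 : Matrix B B ℂ)) := by
        rw [← Matrix.mul_kronecker_mul, Matrix.mul_one]
      simp only [this, Matrix.conjTranspose_mul, Matrix.mul_assoc]
    · rw [Fintype.sum_sigma]
      have : ∀ i k, (M' i k * K i) ⊗ₖ N' i k =
          (M' i k ⊗ₖ N' i k) * (K i ⊗ₖ (1 : Matrix B B ℂ)) := by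
        intro i k
        rw [← Matrix.mul_kronecker_mul, Matrix.mul_one]
      have h3 : ∀ i, ∑ k, ((M' i k * K i) ⊗ₖ N' i k)ᴴ * ((M' i k * K i) ⊗ₖ N' i k) =
          ((K i)ᴴ * K i) ⊗ₖ (1 : Matrix B B ℂ) := by
        intro i
        calc _ = (K i ⊗ₖ (1 : Matrix B B ℂ))ᴴ * (∑ k, (M' i k ⊗ₖ N' i k)ᴴ * (M' i k ⊗ₖ N' i k)) *
              (K i ⊗ₖ (1 : Matrix B B ℂ)) := by
              rw [Matrix.mul_sum, Matrix.sum_mul]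
              refine Finset.sum_congr rfl fun k _ => ?_
              simp only [this, Matrix.conjTranspose_mul, Matrix.mul_assoc]
          _ = _ := by
              rw [h2, Matrix.mul_one, Matrix.conjTranspose_kronecker, ← Matrix.mul_kronecker_mul]
              simp
      simp only [h3]
      have h4 := congrArg (fun Z => Z ⊗ₖ (1 : Matrix B B ℂ)) hK.1
      simp only [Matrix.one_kronecker_one] at h4
      rw [← h4]
      ext p q
      simp [Matrix.sum_apply, Finset.sum_mul]
  | @bob A B B₁ ι _ _ _ _ _ _ _ K hK N hN ih =>
    choose κ hκ M' N' h1 h2 using ih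
    refine ⟨Σ i, κ i, inferInstance, fun k => M' k.1 k.2, fun k => N' k.1 k.2 * K k.1, ?_, ?_⟩
    · intro ρ
      rw [Fintype.sum_sigma]
      refine Finset.sum_congr rfl fun i _ => ?_
      rw [h1]
      refine Finset.sum_congr rfl fun k _ => ?_
      have : M' i k ⊗ₖ (N' i k * K i) = (M' i k ⊗ₖ N' i k) * ((1 : Matrix A A ℂ) ⊗ₖ K i) := by
        rw [← Matrix.mul_kronecker_mul, Matrix.mul_one]
      simp only [this, Matrix.conjTranspose_mul, Matrix.mul_assoc]
    · rw [Fintype.sum_sigma]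
      have : ∀ i k, M' i k ⊗ₖ (N' i k * K i) =
          (M' i k ⊗ₖ N' i k) * ((1 : Matrix A A ℂ) ⊗ₖ K i) := by
        intro i k
        rw [← Matrix.mul_kronecker_mul, Matrix.mul_one]
      have h3 : ∀ i, ∑ k, (M' i k ⊗ₖ (N' i k * K i))ᴴ * (M' i k ⊗ₖ (N' i k * K i)) =
          (1 : Matrix A A ℂ) ⊗ₖ ((K i)ᴴ * K i) := by
        intro i
        calc _ = ((1 : Matrix A A ℂ) ⊗ₖ K i)ᴴ * (∑ k, (M' i k ⊗ₖ N' i k)ᴴ * (M' i k ⊗ₖ N' i k)) *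
              ((1 : Matrix A A ℂ) ⊗ₖ K i) := by
              rw [Matrix.mul_sum, Matrix.sum_mul]
              refine Finset.sum_congr rfl fun k _ => ?_
              simp only [this, Matrix.conjTranspose_mul, Matrix.mul_assoc]
          _ = _ := by
              rw [h2, Matrix.mul_one, Matrix.conjTranspose_kronecker, ← Matrix.mul_kronecker_mul]
              simp
      simp only [h3]
      have h4 := congrArg (fun Z => (1 : Matrix A A ℂ) ⊗ₖ Z) hK.1
      simp only [Matrix.one_kronecker_one] at h4
      rw [← h4]
      ext p q
      simp [Matrix.sum_apply, Finset.mul_sum]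

theorem mul_density_mul_conjTranspose {X Y : Type} [Fintype X] (C : Matrix Y X ℂ)
    (ψ : X → ℂ) : C * density ψ * Cᴴ = density (C *ᵥ ψ) := by
  rw [density, density, Matrix.mul_vecMulVec, Matrix.vecMulVec_mul, Matrix.star_mulVec]

theorem trace_density {X : Type} [Fintype X] (ψ : X → ℂ) :
    (density ψ).trace = ((vecNorm ψ ^ 2 : ℝ) : ℂ) := by
  rw [density, Matrix.trace_vecMulVec, dotProduct_comm, star_dotProduct_self]

/-! ### The coefficient matrix of a bipartite vector -/

/-- The coefficient matrix of a bipartite vector. -/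
def coeffMatrix {A B : Type} (ψ : A × B → ℂ) : Matrix A B ℂ := Matrix.of fun a b => ψ (a, b)

theorem coeffMatrix_kronecker_mulVec {A B A' B' : Type} [Fintype A] [Fintype B]
    (M : Matrix A' A ℂ) (N : Matrix B' B ℂ) (ψ : A × B → ℂ) :
    coeffMatrix ((M ⊗ₖ N) *ᵥ ψ) = M * coeffMatrix ψ * Nᵀ := by
  ext a b
  simp only [coeffMatrix, Matrix.of_apply, Matrix.mulVec, dotProduct, Fintype.sum_prod_type,
    Matrix.kroneckerMap_apply, Matrix.mul_apply, Matrix.transpose_apply, Finset.sum_mul]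
  rw [Finset.sum_comm]
  exact Finset.sum_congr rfl fun _ _ => Finset.sum_congr rfl fun _ _ => by ring

theorem reducedA_density {A B : Type} [Fintype B] (ψ : A × B → ℂ) :
    reducedA (density ψ) = coeffMatrix ψ * (coeffMatrix ψ)ᴴ := by
  ext a a'
  simp [reducedA, density, coeffMatrix, Matrix.vecMulVec_apply, Matrix.mul_apply]

theorem coeffMatrix_copies {A B : Type} (n : ℕ) (Ψ : A × B → ℂ) :
    coeffMatrix (copies n Ψ) = tensorPower n (coeffMatrix Ψ) := rfl

theorem mul_conjTranspose_apply_self {A B : Type} [Fintype B] (M : Matrix A B ℂ) (i : A) :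
    (M * Mᴴ) i i = ((∑ b, ‖M i b‖ ^ 2 : ℝ) : ℂ) := by
  rw [Matrix.mul_apply]
  push_cast
  exact Finset.sum_congr rfl fun b _ => by
    rw [Matrix.conjTranspose_apply, Complex.star_def, Complex.mul_conj']

theorem vecNorm_sq_eq_sum_coeffMatrix {A B : Type} [Fintype A] [Fintype B] (ψ : A × B → ℂ) :
    vecNorm ψ ^ 2 = ∑ a, ∑ b, ‖coeffMatrix ψ a b‖ ^ 2 := by
  rw [vecNorm_sq, Fintype.sum_prod_type]; rfl

theorem sum_norm_sq_eq_trace {A B : Type} [Fintype A] [Fintype B] (M : Matrix A B ℂ) :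
    ((∑ a, ∑ b, ‖M a b‖ ^ 2 : ℝ) : ℂ) = (M * Mᴴ).trace := by
  rw [Matrix.trace]
  push_cast
  refine Finset.sum_congr rfl fun a _ => ?_
  rw [Matrix.diag_apply, mul_conjTranspose_apply_self]
  push_cast
  rfl

theorem dotProduct_eq_trace {A B : Type} [Fintype A] [Fintype B] (φ ψ : A × B → ℂ) :
    star φ ⬝ᵥ ψ = ((coeffMatrix φ)ᴴ * coeffMatrix ψ).trace := by
  simp only [dotProduct, Fintype.sum_prod_type, Matrix.trace, Matrix.diag_apply, Matrix.mul_apply,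
    coeffMatrix, Matrix.conjTranspose_apply, Matrix.of_apply, Pi.star_apply]
  rw [Finset.sum_comm]

theorem norm_apply_self_le_one_of_isStarProjection {A : Type} [Fintype A]
    {P : Matrix A A ℂ} (hP : P * Pᴴ = P) (i : A) : ‖P i i‖ ≤ 1 := by
  have h1 := mul_conjTranspose_apply_self P i
  rw [hP] at h1
  have h2 : ‖P i i‖ ^ 2 ≤ ∑ b, ‖P i b‖ ^ 2 :=
    Finset.single_le_sum (f := fun b => ‖P i b‖ ^ 2) (fun b _ => sq_nonneg _) (Finset.mem_univ i)
  have h3 : ‖P i i‖ = ∑ b, ‖P i b‖ ^ 2 := by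
    rw [h1, Complex.norm_real, Real.norm_of_nonneg (Finset.sum_nonneg fun b _ => sq_nonneg _)]
  rw [← h3] at h2
  nlinarith [norm_nonneg (P i i)]

/-- The reduced state of a bipartite vector is diagonalised by a unitary. -/
theorem exists_unitary_diagonal {A B : Type} [Fintype A] [DecidableEq A] [Fintype B]
    (X : Matrix A B ℂ) (hX : (X * Xᴴ).IsHermitian) :
    ∃ O : Matrix A A ℂ, O * Oᴴ = 1 ∧ Oᴴ * O = 1 ∧
      (Oᴴ * X) * (Oᴴ * X)ᴴ = Matrix.diagonal fun i => ((hX.eigenvalues i : ℝ) : ℂ) := by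
  let O : Matrix A A ℂ := hX.eigenvectorUnitary.1
  have hO1 : O * Oᴴ = 1 := Unitary.mul_star_self_of_mem hX.eigenvectorUnitary.2
  have hO2 : Oᴴ * O = 1 := Unitary.star_mul_self_of_mem hX.eigenvectorUnitary.2
  refine ⟨O, hO1, hO2, ?_⟩
  have h := hX.spectral_theorem
  rw [Unitary.conjStarAlgAut_apply] at h
  change X * Xᴴ = O * _ * Oᴴ at h
  rw [Matrix.conjTranspose_mul, Matrix.conjTranspose_conjTranspose]
  calc Oᴴ * X * (Xᴴ * O) = Oᴴ * (X * Xᴴ) * O := by simp only [Matrix.mul_assoc]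
    _ = (Oᴴ * O) * Matrix.diagonal (RCLike.ofReal ∘ hX.eigenvalues) * (Oᴴ * O) := by
      conv_lhs => rw [h]
      simp only [Matrix.mul_assoc]
    _ = _ := by
      rw [hO2, Matrix.one_mul, Matrix.mul_one]
      rfl

/-- The squared overlap of a vector of Schmidt rank `r` with a `d ⊗ d` maximally entangled state
is at most `r / d` times its squared norm. -/
theorem IsMaximallyEntangled.norm_dotProduct_sq_le {A B : Type} [Fintype A] [DecidableEq A]
    [Fintype B] [DecidableEq B] {d : ℕ} {φ : A × B → ℂ} (hφ : IsMaximallyEntangled d φ)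
    (ψ : A × B → ℂ) :
    ‖star φ ⬝ᵥ ψ‖ ^ 2 ≤ (coeffMatrix ψ).rank / d * vecNorm ψ ^ 2 := by
  obtain ⟨-, P, Q, hP, -, -, -, hred, -⟩ := hφ
  set X := coeffMatrix ψ
  set W := coeffMatrix φ
  rw [reducedA_density] at hred
  have hX : (X * Xᴴ).IsHermitian := Matrix.isHermitian_mul_conjTranspose_self X
  obtain ⟨O, hO1, hO2, hXX⟩ := exists_unitary_diagonal X hX
  set X' := Oᴴ * X with hX'
  set W' := Oᴴ * W with hW'
  have hrow : ∀ i, ∑ b, ‖X' i b‖ ^ 2 = hX.eigenvalues i := by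
    intro i
    have := mul_conjTranspose_apply_self X' i
    rw [hXX, Matrix.diagonal_apply_eq] at this
    exact (Complex.ofReal_injective this).symm
  have hP' : (Oᴴ * P * O) * (Oᴴ * P * O)ᴴ = Oᴴ * P * O := by
    have h1 : Pᴴ = P := hP.isSelfAdjoint
    have h2 : P * P = P := hP.isIdempotentElem
    rw [Matrix.conjTranspose_mul, Matrix.conjTranspose_mul, Matrix.conjTranspose_conjTranspose, h1]
    calc _ = Oᴴ * P * (O * Oᴴ) * P * O := by simp only [Matrix.mul_assoc]
      _ = Oᴴ * (P * P) * O := by rw [hO1]; simp only [Matrix.mul_assoc, Matrix.one_mul]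
      _ = _ := by rw [h2]
  have hWW : W' * W'ᴴ = (d : ℂ)⁻¹ • (Oᴴ * P * O) := by
    rw [hW', Matrix.conjTranspose_mul, Matrix.conjTranspose_conjTranspose]
    calc _ = Oᴴ * (W * Wᴴ) * O := by simp only [Matrix.mul_assoc]
      _ = _ := by rw [hred]; simp
  have hrowW : ∀ i, ∑ b, ‖W' i b‖ ^ 2 ≤ (d : ℝ)⁻¹ := by
    intro i
    have := mul_conjTranspose_apply_self W' i
    rw [hWW, Matrix.smul_apply] at this
    have h2 := congrArg norm this
    rw [Complex.norm_real, Real.norm_of_nonneg (Finset.sum_nonneg fun b _ => sq_nonneg _),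
      norm_smul, norm_inv, Complex.norm_natCast] at h2
    rw [← h2]
    exact mul_le_of_le_one_right (by positivity) (norm_apply_self_le_one_of_isStarProjection hP' i)
  have htr : star φ ⬝ᵥ ψ = ∑ i, ∑ b, star (W' i b) * X' i b := by
    have h1 : Wᴴ * X = W'ᴴ * X' := by
      rw [hW', hX', Matrix.conjTranspose_mul, Matrix.conjTranspose_conjTranspose]
      calc Wᴴ * X = Wᴴ * ((1 : Matrix A A ℂ) * X) := by rw [Matrix.one_mul]
        _ = _ := by rw [← hO1]; simp only [Matrix.mul_assoc]
    rw [dotProduct_eq_trace, h1, Finset.sum_comm]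
    simp [Matrix.trace, Matrix.mul_apply]
  set T := Finset.univ.filter fun i => hX.eigenvalues i ≠ 0
  have hT : (T.card : ℝ) = X.rank := by
    rw [← Matrix.rank_self_mul_conjTranspose, hX.rank_eq_card_non_zero_eigs, Fintype.card_subtype]
  have hzero : ∀ i, i ∉ T → ∀ b, X' i b = 0 := by
    intro i hi b
    have h0 : hX.eigenvalues i = 0 := by simpa [T] using hi
    have h1 := hrow i
    rw [h0, Finset.sum_eq_zero_iff_of_nonneg fun b _ => sq_nonneg _] at h1
    simpa using h1 b (Finset.mem_univ b)
  have htr2 : star φ ⬝ᵥ ψ = ∑ q ∈ T ×ˢ Finset.univ, star (W' q.1 q.2) * X' q.1 q.2 := by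
    rw [htr, Finset.sum_product]
    refine (Finset.sum_subset (Finset.subset_univ T) fun i _ hi => ?_).symm
    exact Finset.sum_eq_zero fun b _ => by rw [hzero i hi b, mul_zero]
  have hnorm : vecNorm ψ ^ 2 = ∑ i, ∑ b, ‖X' i b‖ ^ 2 := by
    apply Complex.ofReal_injective
    rw [vecNorm_sq_eq_sum_coeffMatrix, sum_norm_sq_eq_trace, sum_norm_sq_eq_trace, hX',
      Matrix.conjTranspose_mul, Matrix.conjTranspose_conjTranspose, Matrix.trace_mul_comm (Oᴴ * X),
      Matrix.mul_assoc Xᴴ, ← Matrix.mul_assoc O, hO1, Matrix.one_mul, Matrix.trace_mul_comm]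
  calc ‖star φ ⬝ᵥ ψ‖ ^ 2
      ≤ (∑ q ∈ T ×ˢ Finset.univ, ‖W' q.1 q.2‖ * ‖X' q.1 q.2‖) ^ 2 := by
        rw [htr2]
        refine pow_le_pow_left₀ (norm_nonneg _) ((norm_sum_le _ _).trans ?_) 2
        exact Finset.sum_le_sum fun q _ => by rw [norm_mul, norm_star]
    _ ≤ (∑ q ∈ T ×ˢ Finset.univ, ‖W' q.1 q.2‖ ^ 2) * ∑ q ∈ T ×ˢ Finset.univ, ‖X' q.1 q.2‖ ^ 2 :=
        Finset.sum_mul_sq_le_sq_mul_sq _ _ _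
    _ ≤ (X.rank / d) * vecNorm ψ ^ 2 := by
        refine mul_le_mul ?_ ?_ (Finset.sum_nonneg fun q _ => sq_nonneg _) (by positivity)
        · rw [Finset.sum_product, ← hT, div_eq_mul_inv, ← nsmul_eq_mul]
          exact Finset.sum_le_card_nsmul _ _ _ fun i _ => hrowW i
        · rw [Finset.sum_product, hnorm]
          exact Finset.sum_le_univ_sum_of_nonneg fun i => Finset.sum_nonneg fun b _ => sq_nonneg _

/-! ### The converse bound -/

theorem dotProduct_kraus {X Y κ : Type} [Fintype X] [DecidableEq X] [Fintype Y] [Fintype κ]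
    {C : κ → Matrix Y X ℂ} (hC : ∑ k, (C k)ᴴ * C k = 1) (u v : X → ℂ) :
    ∑ k, star (C k *ᵥ u) ⬝ᵥ (C k *ᵥ v) = star u ⬝ᵥ v := by
  have : ∀ k, star (C k *ᵥ u) ⬝ᵥ (C k *ᵥ v) = star u ⬝ᵥ (((C k)ᴴ * C k) *ᵥ v) := by
    intro k
    rw [Matrix.star_mulVec, ← Matrix.dotProduct_mulVec, Matrix.mulVec_mulVec]
  simp only [this]
  rw [← dotProduct_sum, ← Matrix.sum_mulVec, hC, Matrix.one_mulVec]

theorem sum_vecNorm_sq_kraus {X Y κ : Type} [Fintype X] [DecidableEq X] [Fintype Y] [Fintype κ]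
    {C : κ → Matrix Y X ℂ} (hC : ∑ k, (C k)ᴴ * C k = 1) (u : X → ℂ) :
    ∑ k, vecNorm (C k *ᵥ u) ^ 2 = vecNorm u ^ 2 := by
  have := dotProduct_kraus hC u u
  simp only [star_dotProduct_self] at this
  exact_mod_cast this

theorem vecNorm_sub_smul_sq {X : Type} [Fintype X] {φ : X → ℂ} (hφ : vecNorm φ = 1) (v : X → ℂ) :
    vecNorm (v - (star φ ⬝ᵥ v) • φ) ^ 2 = vecNorm v ^ 2 - ‖star φ ⬝ᵥ v‖ ^ 2 := by
  apply Complex.ofReal_injective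
  have h1 : star φ ⬝ᵥ φ = 1 := by rw [star_dotProduct_self, hφ]; simp
  have h2 : star v ⬝ᵥ φ = star (star φ ⬝ᵥ v) :=
    Matrix.star_dotProduct _ _
  set c := star φ ⬝ᵥ v
  rw [← star_dotProduct_self, star_sub, star_smul, sub_dotProduct, dotProduct_sub, dotProduct_sub,
    dotProduct_smul, smul_dotProduct, smul_dotProduct, dotProduct_smul, h1, h2,
    star_dotProduct_self]
  push_cast
  rw [← Complex.mul_conj', smul_eq_mul, smul_eq_mul, smul_eq_mul, smul_eq_mul, ← Complex.star_def]
  ring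

/-- If an LIOCC map sends `ψ` close to a `d ⊗ d` maximally entangled state, then the weight of `ψ`
on any local subspace of dimension `m` is not much larger than `m / d`. -/
theorem IsLIOCC.sqrt_weight_le {A' B' : Type} [Fintype A'] [DecidableEq A'] [Fintype B']
    [DecidableEq B'] {A B : Type} [Fintype A] [DecidableEq A] [Fintype B] [DecidableEq B]
    {L : Matrix (A × B) (A × B) ℂ → Matrix (A' × B') (A' × B') ℂ} (hL : IsLIOCC L)
    {d : ℕ} {Λ : A' × B' → ℂ} (hΛ : IsMaximallyEntangled d Λ) {ψ : A × B → ℂ}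
    (hψ : IsPureState ψ) {ε : ℝ} (hε : traceDistance (L (density ψ)) (density Λ) ≤ ε)
    {P : Matrix A A ℂ} (hP : Pᴴ * P = P) {m : ℕ} (hm : P.rank ≤ m) :
    √(∑ a, ∑ b, ‖(P * coeffMatrix ψ) a b‖ ^ 2) ≤ √(m / d) + √(2 * ε) := by
  obtain ⟨κ, _, M, N, h1, h2⟩ := hL.exists_kraus
  set C : κ → Matrix (A' × B') (A × B) ℂ := fun k => M k ⊗ₖ N k with hCdef
  have hC : ∑ k, (C k)ᴴ * C k = 1 := h2
  set u : A × B → ℂ := (P ⊗ₖ (1 : Matrix B B ℂ)) *ᵥ ψ with hu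
  have hucoeff : coeffMatrix u = P * coeffMatrix ψ := by
    rw [hu, coeffMatrix_kronecker_mulVec]; simp
  have hΛ1 := hΛ.1.vecNorm_eq
  have hψ1 := hψ.vecNorm_eq
  have hx : ∑ a, ∑ b, ‖(P * coeffMatrix ψ) a b‖ ^ 2 = vecNorm u ^ 2 := by
    rw [vecNorm_sq_eq_sum_coeffMatrix, hucoeff]
  rw [hx, Real.sqrt_sq (vecNorm_nonneg _)]
  have huu : star u ⬝ᵥ ψ = ((vecNorm u ^ 2 : ℝ) : ℂ) := by
    rw [← star_dotProduct_self, hu, Matrix.star_mulVec, ← Matrix.dotProduct_mulVec,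
      ← Matrix.dotProduct_mulVec, Matrix.mulVec_mulVec, Matrix.conjTranspose_kronecker,
      ← Matrix.mul_kronecker_mul, hP]
    have hP' : Pᴴ = P := by
      rw [← hP, Matrix.conjTranspose_mul, Matrix.conjTranspose_conjTranspose]
    simp [hP']
  set a : κ → ℂ := fun k => star Λ ⬝ᵥ (C k *ᵥ u)
  set b : κ → ℂ := fun k => star Λ ⬝ᵥ (C k *ᵥ ψ)
  have hLψ : L (density ψ) = ∑ k, density (C k *ᵥ ψ) := by
    rw [h1]
    exact Finset.sum_congr rfl fun k _ => mul_density_mul_conjTranspose _ _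
  -- the fidelity of the output with the target
  have hF : 1 - ∑ k, ‖b k‖ ^ 2 ≤ 2 * ε := by
    have e1 : star Λ ⬝ᵥ ((L (density ψ) - density Λ) *ᵥ Λ) = ((∑ k, ‖b k‖ ^ 2 - 1 : ℝ) : ℂ) := by
      have hd : ∀ v : A' × B' → ℂ, star Λ ⬝ᵥ (density v *ᵥ Λ) = ((‖star Λ ⬝ᵥ v‖ ^ 2 : ℝ) : ℂ) := by
        intro v
        have hs : star v ⬝ᵥ Λ = star (star Λ ⬝ᵥ v) := Matrix.star_dotProduct _ _
        rw [density, Matrix.vecMulVec_mulVec, hs]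
        simp only [op_smul_eq_smul, dotProduct_smul, smul_eq_mul]
        push_cast
        rw [Complex.star_def, Complex.conj_mul']
      rw [hLψ, Matrix.sub_mulVec, Matrix.sum_mulVec, dotProduct_sub, dotProduct_sum]
      simp only [hd]
      rw [star_dotProduct_self, hΛ1]
      push_cast
      simp [b]
    have e2 : ‖star Λ ⬝ᵥ ((L (density ψ) - density Λ) *ᵥ Λ)‖ ≤ 2 * ε := by
      refine (norm_dotProduct_le _ _).trans ?_
      rw [hΛ1, one_mul]
      refine (vecNorm_mulVec_le _ _).trans ?_
      rw [hΛ1, mul_one]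
      rw [traceDistance] at hε
      linarith
    rw [e1, Complex.norm_real, Real.norm_eq_abs] at e2
    linarith [neg_abs_le (∑ k, ‖b k‖ ^ 2 - 1)]
  have hε0 : 0 ≤ 2 * ε := by
    have : ∑ k, ‖b k‖ ^ 2 ≤ 1 := by
      calc ∑ k, ‖b k‖ ^ 2 ≤ ∑ k, vecNorm (C k *ᵥ ψ) ^ 2 := by
            refine Finset.sum_le_sum fun k _ => pow_le_pow_left₀ (norm_nonneg _) ?_ 2
            have := norm_dotProduct_le Λ (C k *ᵥ ψ)
            rwa [hΛ1, one_mul] at this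
        _ = 1 := by rw [sum_vecNorm_sq_kraus hC, hψ1]; norm_num
    linarith
  have hsplit : ((vecNorm u ^ 2 : ℝ) : ℂ) = ∑ k, star (a k) * b k +
      ∑ k, star (C k *ᵥ u) ⬝ᵥ (C k *ᵥ ψ - b k • Λ) := by
    rw [← huu, ← dotProduct_kraus hC, ← Finset.sum_add_distrib]
    refine Finset.sum_congr rfl fun k _ => ?_
    have hs : star (C k *ᵥ u) ⬝ᵥ Λ = star (a k) := Matrix.star_dotProduct _ _
    rw [dotProduct_sub, dotProduct_smul, hs, smul_eq_mul]
    ring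
  have hA : ‖∑ k, star (a k) * b k‖ ≤ √(m / d) * vecNorm u := by
    calc ‖∑ k, star (a k) * b k‖ ≤ ∑ k, ‖a k‖ * ‖b k‖ :=
          (norm_sum_le _ _).trans (Finset.sum_le_sum fun k _ => by rw [norm_mul, norm_star])
      _ ≤ √(∑ k, ‖a k‖ ^ 2) * √(∑ k, ‖b k‖ ^ 2) := Real.sum_mul_le_sqrt_mul_sqrt _ _ _
      _ ≤ √(m / d * vecNorm u ^ 2) * 1 := by
          refine mul_le_mul (Real.sqrt_le_sqrt ?_) ?_ (Real.sqrt_nonneg _) (Real.sqrt_nonneg _)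
          · rw [← sum_vecNorm_sq_kraus hC u, Finset.mul_sum]
            refine Finset.sum_le_sum fun k _ => (hΛ.norm_dotProduct_sq_le _).trans ?_
            refine mul_le_mul_of_nonneg_right ?_ (sq_nonneg _)
            refine div_le_div_of_nonneg_right ?_ (Nat.cast_nonneg _)
            rw [coeffMatrix_kronecker_mulVec, hucoeff]
            have h3 : (M k * (P * coeffMatrix ψ) * (N k)ᵀ).rank ≤ P.rank :=
              (Matrix.rank_mul_le_left _ _).trans ((Matrix.rank_mul_le_right _ _).trans
                (Matrix.rank_mul_le_left _ _))
            exact_mod_cast h3.trans hm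
          · rw [Real.sqrt_le_one]
            calc ∑ k, ‖b k‖ ^ 2 ≤ ∑ k, vecNorm (C k *ᵥ ψ) ^ 2 := by
                  refine Finset.sum_le_sum fun k _ => pow_le_pow_left₀ (norm_nonneg _) ?_ 2
                  have := norm_dotProduct_le Λ (C k *ᵥ ψ)
                  rwa [hΛ1, one_mul] at this
              _ = 1 := by rw [sum_vecNorm_sq_kraus hC, hψ1]; norm_num
      _ = √(m / d) * vecNorm u := by
          rw [mul_one, Real.sqrt_mul (by positivity), Real.sqrt_sq (vecNorm_nonneg _)]
  have hB : ‖∑ k, star (C k *ᵥ u) ⬝ᵥ (C k *ᵥ ψ - b k • Λ)‖ ≤ √(2 * ε) * vecNorm u := by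
    calc _ ≤ ∑ k, vecNorm (C k *ᵥ u) * vecNorm (C k *ᵥ ψ - b k • Λ) :=
          (norm_sum_le _ _).trans (Finset.sum_le_sum fun k _ => norm_dotProduct_le _ _)
      _ ≤ √(∑ k, vecNorm (C k *ᵥ u) ^ 2) * √(∑ k, vecNorm (C k *ᵥ ψ - b k • Λ) ^ 2) :=
          Real.sum_mul_le_sqrt_mul_sqrt _ _ _
      _ ≤ vecNorm u * √(2 * ε) := by
          rw [sum_vecNorm_sq_kraus hC, Real.sqrt_sq (vecNorm_nonneg _)]
          refine mul_le_mul_of_nonneg_left (Real.sqrt_le_sqrt ?_) (vecNorm_nonneg _)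
          simp only [b, vecNorm_sub_smul_sq hΛ1, Finset.sum_sub_distrib]
          rw [sum_vecNorm_sq_kraus hC, hψ1]
          simpa using hF
      _ = _ := mul_comm _ _
  have hfin : vecNorm u * vecNorm u ≤ (√(m / d) + √(2 * ε)) * vecNorm u := by
    have h3 := congrArg norm hsplit
    rw [Complex.norm_real, Real.norm_of_nonneg (sq_nonneg _)] at h3
    have h4 := norm_add_le (∑ k, star (a k) * b k)
      (∑ k, star (C k *ᵥ u) ⬝ᵥ (C k *ᵥ ψ - b k • Λ))
    rw [← h3] at h4
    nlinarith
  rcases (vecNorm_nonneg u).eq_or_lt with h0 | h0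
  · rw [← h0]; positivity
  · exact le_of_mul_le_mul_right hfin h0

/-! ### The Schmidt spectrum of many copies -/

/-- The Schmidt spectrum of a pure state, in matrix form. -/
theorem exists_schmidt {A B : Type} [Fintype A] [DecidableEq A] [Fintype B] {Ψ : A × B → ℂ}
    (hΨ : IsPureState Ψ) :
    ∃ (U : Matrix A A ℂ) (lam : A → ℝ), U * Uᴴ = 1 ∧ Uᴴ * U = 1 ∧
      (Uᴴ * coeffMatrix Ψ) * (Uᴴ * coeffMatrix Ψ)ᴴ = Matrix.diagonal (fun i => (lam i : ℂ)) ∧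
      (∀ i, 0 ≤ lam i) ∧ ∑ i, lam i = 1 ∧
      entanglementEntropy Ψ = ∑ i, lam i * -Real.logb 2 (lam i) := by
  have hred := reducedA_density Ψ
  have hX : (coeffMatrix Ψ * (coeffMatrix Ψ)ᴴ).IsHermitian :=
    Matrix.isHermitian_mul_conjTranspose_self _
  obtain ⟨U, h1, h2, h3⟩ := exists_unitary_diagonal (coeffMatrix Ψ) hX
  refine ⟨U, hX.eigenvalues, h1, h2, h3,
    (Matrix.posSemidef_self_mul_conjTranspose _).eigenvalues_nonneg, ?_, ?_⟩
  · apply Complex.ofReal_injective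
    have := hX.trace_eq_sum_eigenvalues
    rw [← sum_norm_sq_eq_trace, ← vecNorm_sq_eq_sum_coeffMatrix, hΨ.vecNorm_eq] at this
    push_cast at this ⊢
    rw [one_pow] at this
    exact this.symm
  · have : ∀ (ρ : Matrix A A ℂ) (h : ρ.IsHermitian), ρ = coeffMatrix Ψ * (coeffMatrix Ψ)ᴴ →
        vonNeumannEntropy h = ∑ i, hX.eigenvalues i * -Real.logb 2 (hX.eigenvalues i) := by
      rintro ρ h rfl
      simp [vonNeumannEntropy]
    exact this _ _ hred

theorem sum_word_mul_sum {Y : Type} [Fintype Y] {p : Y → ℝ} (hp : ∑ y, p y = 1) (f : Y → ℝ)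
    (n : ℕ) : ∑ w : Fin n → Y, (∏ i, p (w i)) * ∑ i, f (w i) = n * ∑ y, p y * f y := by
  have hg : ∑ y, p y * (f y - ∑ y, p y * f y) = 0 := by
    simp only [mul_sub, Finset.sum_sub_distrib, ← Finset.sum_mul, hp]
    ring
  have h1 := sum_word_mean_zero hp hg n
  have h2 := sum_prod_word p n
  rw [hp, one_pow] at h2
  simp only [Finset.sum_sub_distrib, mul_sub, ← Finset.sum_mul, h2] at h1
  simp at h1
  linarith

theorem prod_mul_neg_logb {Y : Type} (p : Y → ℝ) {n : ℕ} (w : Fin n → Y) :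
    (∏ i, p (w i)) * -Real.logb 2 (∏ i, p (w i)) =
      (∏ i, p (w i)) * ∑ i, -Real.logb 2 (p (w i)) := by
  by_cases h : ∏ i, p (w i) = 0
  · rw [h, zero_mul, zero_mul]
  · rw [Real.logb_prod _ _ fun i _ => (Finset.prod_ne_zero_iff.mp h) i (Finset.mem_univ i),
      Finset.sum_neg_distrib]

theorem copies_isPureState {A B : Type} [Fintype A] [Fintype B] {Ψ : A × B → ℂ}
    (hΨ : IsPureState Ψ) (n : ℕ) : IsPureState (copies n Ψ) := by
  have h := sum_prod_word (fun q => ‖Ψ q‖ ^ 2) n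
  rw [show ∑ q, ‖Ψ q‖ ^ 2 = 1 from hΨ, one_pow] at h
  rw [IsPureState, ← h, ← (Equiv.arrowProdEquivProdArrow (Fin n) (fun _ => A) (fun _ => B)).sum_comp]
  refine Finset.sum_congr rfl fun w _ => ?_
  simp [copies, Equiv.arrowProdEquivProdArrow, norm_prod, Finset.prod_pow]

theorem tensorPower_schmidt {A B : Type} [Fintype A] [DecidableEq A] [Fintype B] {Y : Matrix A B ℂ}
    {lam : A → ℝ} (hY : Y * Yᴴ = Matrix.diagonal fun i => (lam i : ℂ)) (n : ℕ) :
    tensorPower n Y * (tensorPower n Y)ᴴ =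
      Matrix.diagonal fun w => ((∏ i, lam (w i) : ℝ) : ℂ) := by
  rw [← tensorPower_conjTranspose, ← tensorPower_mul, hY, tensorPower_diagonal]
  push_cast
  rfl

theorem sum_norm_sq_row {A B : Type} [DecidableEq A] [Fintype B] {Y : Matrix A B ℂ}
    {lam : A → ℝ} (hY : Y * Yᴴ = Matrix.diagonal fun i => (lam i : ℂ)) (i : A) :
    ∑ b, ‖Y i b‖ ^ 2 = lam i := by
  have := mul_conjTranspose_apply_self Y i
  rw [hY, Matrix.diagonal_apply_eq] at this
  exact (Complex.ofReal_injective this).symm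

/-- The projection onto the span of the columns of `U` that are indexed by `S`. -/
def spanProj {A : Type} [Fintype A] [DecidableEq A] (U : Matrix A A ℂ) (S : Finset A) :
    Matrix A A ℂ :=
  U * Matrix.diagonal (fun i => if i ∈ S then 1 else 0) * Uᴴ

theorem diagonal_indicator_mul_self {A : Type} [Fintype A] [DecidableEq A] (S : Finset A) :
    Matrix.diagonal (fun i => if i ∈ S then (1 : ℂ) else 0) *
      Matrix.diagonal (fun i => if i ∈ S then (1 : ℂ) else 0) =
      Matrix.diagonal (fun i => if i ∈ S then (1 : ℂ) else 0) := by
  rw [Matrix.diagonal_mul_diagonal]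
  congr 1
  ext i
  split_ifs <;> simp

theorem spanProj_conjTranspose {A : Type} [Fintype A] [DecidableEq A] (U : Matrix A A ℂ)
    (S : Finset A) : (spanProj U S)ᴴ = spanProj U S := by
  have : (Matrix.diagonal (fun i => if i ∈ S then (1 : ℂ) else 0))ᴴ =
      Matrix.diagonal (fun i => if i ∈ S then (1 : ℂ) else 0) := by
    rw [Matrix.diagonal_conjTranspose]
    congr 1
    ext i
    simp only [Pi.star_apply]
    split_ifs <;> simp
  rw [spanProj, Matrix.conjTranspose_mul, Matrix.conjTranspose_mul,
    Matrix.conjTranspose_conjTranspose, this, Matrix.mul_assoc]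

theorem spanProj_mul_self {A : Type} [Fintype A] [DecidableEq A] {U : Matrix A A ℂ}
    (hU : Uᴴ * U = 1) (S : Finset A) : spanProj U S * spanProj U S = spanProj U S := by
  rw [spanProj]
  set D := Matrix.diagonal (fun i => if i ∈ S then (1 : ℂ) else 0)
  calc U * D * Uᴴ * (U * D * Uᴴ) = U * D * (Uᴴ * U) * (D * Uᴴ) := by
        simp only [Matrix.mul_assoc]
    _ = U * (D * D) * Uᴴ := by rw [hU, Matrix.mul_one]; simp only [Matrix.mul_assoc]
    _ = U * D * Uᴴ := by rw [diagonal_indicator_mul_self]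

theorem rank_spanProj_le {A : Type} [Fintype A] [DecidableEq A] (U : Matrix A A ℂ)
    (S : Finset A) : (spanProj U S).rank ≤ S.card := by
  refine (Matrix.rank_mul_le_left _ _).trans ((Matrix.rank_mul_le_right _ _).trans ?_)
  rw [Matrix.rank_diagonal, Fintype.card_subtype]
  refine Finset.card_le_card fun i hi => ?_
  by_contra h
  simp [h] at hi

theorem sum_norm_sq_spanProj_mul {A B : Type} [Fintype A] [DecidableEq A] [Fintype B]
    {U : Matrix A A ℂ} (hU : Uᴴ * U = 1) (X : Matrix A B ℂ) (S : Finset A) :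
    ∑ a, ∑ b, ‖(spanProj U S * X) a b‖ ^ 2 = ∑ a ∈ S, ∑ b, ‖(Uᴴ * X) a b‖ ^ 2 := by
  set D := Matrix.diagonal (fun i => if i ∈ S then (1 : ℂ) else 0) with hD
  have h1 : ∑ a ∈ S, ∑ b, ‖(Uᴴ * X) a b‖ ^ 2 = ∑ a, ∑ b, ‖(D * (Uᴴ * X)) a b‖ ^ 2 := by
    rw [← Finset.sum_filter_add_sum_filter_not Finset.univ (· ∈ S) (fun a =>
      ∑ b, ‖(D * (Uᴴ * X)) a b‖ ^ 2), Finset.filter_univ_mem, Finset.sum_eq_zero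
      (s := Finset.univ.filter (· ∉ S)), add_zero]
    · refine Finset.sum_congr rfl fun a ha => Finset.sum_congr rfl fun b _ => ?_
      rw [hD, Matrix.diagonal_mul, if_pos ha, one_mul]
    · intro a ha
      refine Finset.sum_eq_zero fun b _ => ?_
      rw [hD, Matrix.diagonal_mul, if_neg (Finset.mem_filter.mp ha).2]
      simp
  rw [h1]
  apply Complex.ofReal_injective
  rw [sum_norm_sq_eq_trace, sum_norm_sq_eq_trace, spanProj]
  have h2 : U * D * Uᴴ * X = U * (D * (Uᴴ * X)) := by simp only [Matrix.mul_assoc]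
  rw [h2]
  set Z := D * (Uᴴ * X)
  rw [Matrix.conjTranspose_mul, Matrix.trace_mul_comm, Matrix.mul_assoc, ← Matrix.mul_assoc Uᴴ, hU,
    Matrix.one_mul, Matrix.trace_mul_comm]

theorem IsMaximallyEntangled.pos {A B : Type} [Fintype A] [DecidableEq A]
    [Fintype B] [DecidableEq B] {d : ℕ} {φ : A × B → ℂ} (hφ : IsMaximallyEntangled d φ) :
    0 < d := by
  rw [Nat.pos_iff_ne_zero]
  rintro rfl
  obtain ⟨h1, P, Q, -, -, -, -, hred, -⟩ := hφ
  rw [reducedA_density] at hred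
  have h2 := sum_norm_sq_eq_trace (coeffMatrix φ)
  rw [hred, ← vecNorm_sq_eq_sum_coeffMatrix, h1.vecNorm_eq] at h2
  simp at h2

theorem mul_neg_logb_nonneg {x : ℝ} (h0 : 0 ≤ x) (h1 : x ≤ 1) : 0 ≤ x * -Real.logb 2 x :=
  mul_nonneg h0 (neg_nonneg.mpr (Real.logb_nonpos (by norm_num) h0 h1))

/-- A distribution `p` that has weight `x` on the values exceeding `s` has entropy at least
`(1 - x) * log (1 / s)`. -/
theorem one_sub_mul_le_entropy {X : Type} [Fintype X] {p : X → ℝ} (h0 : ∀ i, 0 ≤ p i)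
    (h1 : ∑ i, p i = 1) (s : ℝ) :
    (1 - ∑ i with s < p i, p i) * -Real.logb 2 s ≤ ∑ i, p i * -Real.logb 2 (p i) := by
  have hle : ∀ i, p i ≤ 1 := fun i => by
    rw [← h1]; exact Finset.single_le_sum (fun i _ => h0 i) (Finset.mem_univ i)
  rw [← Finset.sum_filter_add_sum_filter_not Finset.univ (fun i => s < p i)] at h1
  rw [← Finset.sum_filter_add_sum_filter_not Finset.univ (fun i => s < p i)
    fun i => p i * -Real.logb 2 (p i)]
  have e : 1 - ∑ i with s < p i, p i = ∑ i with ¬ s < p i, p i := by linarith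
  rw [e, Finset.sum_mul]
  refine le_add_of_nonneg_of_le
    (Finset.sum_nonneg fun i _ => mul_neg_logb_nonneg (h0 i) (hle i)) (Finset.sum_le_sum ?_)
  intro i hi
  have hi' : p i ≤ s := not_lt.mp (Finset.mem_filter.mp hi).2
  rcases (h0 i).eq_or_lt with h | h
  · rw [← h]; simp
  · refine mul_le_mul_of_nonneg_left (neg_le_neg ?_) (h0 i)
    exact Real.logb_le_logb_of_le (by norm_num) h hi'

theorem converse_bound {A B : Type} [Fintype A] [DecidableEq A] [Fintype B] [DecidableEq B]
    {Ψ : A × B → ℂ} (hΨ : IsPureState Ψ) {n : ℕ} {A' B' : Type} [Fintype A'] [DecidableEq A']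
    [Fintype B'] [DecidableEq B']
    {L : Matrix ((Fin n → A) × (Fin n → B)) ((Fin n → A) × (Fin n → B)) ℂ →
      Matrix (A' × B') (A' × B') ℂ} (hL : IsLIOCC L) {d : ℕ} {Λ : A' × B' → ℂ}
    (hΛ : IsMaximallyEntangled d Λ) {ε : ℝ}
    (hε : traceDistance (L (density (copies n Ψ))) (density Λ) ≤ ε) {t : ℝ} (ht : 1 < t) :
    ∃ x : ℝ, x ≤ 1 ∧ x * (1 - 1 / √t) ^ 2 ≤ 2 * ε ∧
      (1 - x) * (Real.logb 2 d - Real.logb 2 t) ≤ n * entanglementEntropy Ψ := by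
  obtain ⟨U, lam, hU1, hU2, hY, hlam0, hlam1, hE⟩ := exists_schmidt hΨ
  have hd : (0 : ℝ) < d := by exact_mod_cast hΛ.pos
  have ht0 : 0 < t := by linarith
  set p : (Fin n → A) → ℝ := fun w => ∏ i, lam (w i) with hp
  have hp0 : ∀ w, 0 ≤ p w := fun w => Finset.prod_nonneg fun i _ => hlam0 _
  have hp1 : ∑ w, p w = 1 := by rw [sum_prod_word, hlam1, one_pow]
  set S : Finset (Fin n → A) := Finset.univ.filter fun w => t / d < p w with hS
  set x := ∑ w ∈ S, p w with hx
  have hx0 : 0 ≤ x := Finset.sum_nonneg fun w _ => hp0 w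
  have hx1 : x ≤ 1 := by
    rw [← hp1]; exact Finset.sum_le_univ_sum_of_nonneg hp0
  have hcard : (S.card : ℝ) / d ≤ x / t := by
    have h1 : S.card • (t / d) ≤ x :=
      Finset.card_nsmul_le_sum _ _ _ fun w hw => (Finset.mem_filter.mp hw).2.le
    rw [nsmul_eq_mul] at h1
    rw [le_div_iff₀ ht0]
    calc (S.card : ℝ) / d * t = S.card * (t / d) := by ring
      _ ≤ x := h1
  have hYn := tensorPower_schmidt hY n
  have hUn : (tensorPower n U)ᴴ * tensorPower n U = 1 := by
    rw [← tensorPower_conjTranspose, ← tensorPower_mul, hU2, tensorPower_one]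
  have hw := hL.sqrt_weight_le hΛ (copies_isPureState hΨ n) hε
    (P := spanProj (tensorPower n U) S)
    (by rw [spanProj_conjTranspose, spanProj_mul_self hUn]) (rank_spanProj_le _ S)
  rw [sum_norm_sq_spanProj_mul hUn, coeffMatrix_copies, ← tensorPower_conjTranspose,
    ← tensorPower_mul] at hw
  simp only [sum_norm_sq_row hYn] at hw
  refine ⟨x, hx1, ?_, ?_⟩
  · have hst : 1 < √t := by rw [Real.lt_sqrt (by norm_num)]; simpa using ht
    have h1 : √x ≤ √x / √t + √(2 * ε) := by
      refine hw.trans (add_le_add_left ?_ _)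
      rw [← Real.sqrt_div hx0]
      exact Real.sqrt_le_sqrt hcard
    have h2 : √x * (1 - 1 / √t) ≤ √(2 * ε) := by
      have : √x * (1 - 1 / √t) = √x - √x / √t := by ring
      linarith
    have h3 : 0 ≤ 1 - 1 / √t := by
      rw [sub_nonneg, div_le_one (by linarith)]; exact hst.le
    have hε0 : 0 ≤ 2 * ε := by
      have : 0 ≤ traceNorm (L (density (copies n Ψ)) - density Λ) :=
        Finset.sum_nonneg fun i _ => Real.sqrt_nonneg _
      rw [traceDistance] at hε
      linarith
    have h4 := pow_le_pow_left₀ (mul_nonneg (Real.sqrt_nonneg x) h3) h2 2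
    rwa [mul_pow, Real.sq_sqrt hx0, Real.sq_sqrt hε0] at h4
  · have h1 := one_sub_mul_le_entropy hp0 hp1 (t / d)
    have h2 : ∑ w, p w * -Real.logb 2 (p w) = n * entanglementEntropy Ψ := by
      simp only [hp, prod_mul_neg_logb]
      rw [sum_word_mul_sum hlam1 fun y => -Real.logb 2 (lam y), hE]
    rw [h2, Real.logb_div ht0.ne' hd.ne'] at h1
    calc _ = (1 - x) * -(Real.logb 2 t - Real.logb 2 d) := by ring
      _ ≤ _ := h1

/-- No achievable rate exceeds the entropy of entanglement. -/
theorem IsAchievableRate.le_entanglementEntropy {A B : Type} [Fintype A] [DecidableEq A] [Fintype B]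
    [DecidableEq B] {Ψ : A × B → ℂ} (hΨ : IsPureState Ψ) {R : ℝ} (hR : IsAchievableRate Ψ R) :
    R ≤ entanglementEntropy Ψ := by
  by_contra! hlt
  set E := entanglementEntropy Ψ
  have hE0 : 0 ≤ E := by
    obtain ⟨U, lam, -, -, -, hlam0, hlam1, hE⟩ := exists_schmidt hΨ
    rw [show E = _ from hE]
    refine Finset.sum_nonneg fun i _ => mul_neg_logb_nonneg (hlam0 i) ?_
    rw [← hlam1]; exact Finset.single_le_sum (fun i _ => hlam0 i) (Finset.mem_univ i)
  set g := R - E with hg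
  have hg0 : 0 < g := sub_pos.mpr hlt
  set t : ℝ := 2 ^ (g / 4) with ht
  have ht1 : 1 < t := Real.one_lt_rpow (by norm_num) (by positivity)
  have hlogt : Real.logb 2 t = g / 4 := Real.logb_rpow (by norm_num) (by norm_num)
  set c := (1 - 1 / √t) ^ 2 with hc
  have hc0 : 0 < c := by
    have hst : 1 < √t := by rw [Real.lt_sqrt (by norm_num)]; simpa using ht1
    have : 0 < 1 - 1 / √t := by
      rw [sub_pos, div_lt_one (by linarith)]; exact hst
    positivity
  set ε := min (g / 4) (c * g / (8 * (E + g)))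
  have hε0 : 0 < ε := lt_min (by positivity) (by positivity)
  obtain ⟨n, hn, a, b, L, d, Λ, hL, hΛ, hdist, hrate⟩ := hR ε hε0
  obtain ⟨x, hx1, hx2, hx3⟩ := converse_bound hΨ hL hΛ hdist ht1
  have hn1 : (1 : ℝ) ≤ n := by exact_mod_cast hn
  have hε1 : ε ≤ g / 4 := min_le_left _ _
  have hε2 : ε ≤ c * g / (8 * (E + g)) := min_le_right _ _
  have hxs : x * (E + g) ≤ g / 4 := by
    have h1 : x * c ≤ 2 * (c * g / (8 * (E + g))) := hx2.trans (by linarith)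
    have h2 : 2 * (c * g / (8 * (E + g))) = c * (g / 4 / (E + g)) := by
      field_simp; norm_num
    rw [h2, mul_comm x c] at h1
    exact (le_div_iff₀ (by positivity)).mp (le_of_mul_le_mul_left h1 hc0)
  have hlogd : (n : ℝ) * (R - ε) ≤ Real.logb 2 d := by
    have := hrate.le
    rw [one_div, ← div_eq_inv_mul, le_div_iff₀ (by linarith)] at this
    linarith
  have h5 : (n : ℝ) * (E + g / 2) ≤ Real.logb 2 d - Real.logb 2 t := by
    rw [hlogt]
    nlinarith
  have h6 : (1 - x) * (n * (E + g / 2)) ≤ n * E :=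
    (mul_le_mul_of_nonneg_left h5 (by linarith)).trans hx3
  have h7 : (1 - x) * (E + g / 2) ≤ E := by
    refine le_of_mul_le_mul_left ?_ (show (0 : ℝ) < n by linarith)
    linarith
  rcases le_or_gt x 0 with h | h
  · nlinarith
  · nlinarith

/-! ### Incoherent operations -/

/-- A Kraus operator that sends each basis vector to a multiple of a basis vector is incoherent. -/
theorem isDiag_mul_mul_conjTranspose {X Y : Type} [Fintype X] [DecidableEq X] {K : Matrix Y X ℂ}
    (hK : ∀ x y y', K y x ≠ 0 → K y' x ≠ 0 → y = y') {ρ : Matrix X X ℂ} (hρ : ρ.IsDiag) :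
    (K * ρ * Kᴴ).IsDiag := by
  intro y y' hy
  rw [← hρ.diagonal_diag, Matrix.mul_apply]
  refine Finset.sum_eq_zero fun x _ => ?_
  rw [Matrix.mul_diagonal, Matrix.conjTranspose_apply]
  by_cases h : K y x = 0
  · simp [h]
  · have : K y' x = 0 := by
      by_contra h'
      exact hy (hK x y y' h h')
    simp [this]

/-- The measurement of the label `k x` of a basis vector `x`, followed by the relabelling of `x`
as `h x`. -/
def relabelKraus {X S κ : Type} [DecidableEq S] [DecidableEq κ] (h : X → S) (k : X → κ) (j : κ) :
    Matrix S X ℂ :=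
  Matrix.of fun s x => if s = h x ∧ k x = j then 1 else 0

theorem relabelKraus_isIncoherentOperation {X S κ : Type} [Fintype X] [DecidableEq X] [Fintype S]
    [DecidableEq S] [Fintype κ] [DecidableEq κ] {h : X → S} {k : X → κ}
    (hinj : ∀ x x', h x = h x' → k x = k x' → x = x') :
    IsIncoherentOperation (relabelKraus h k) := by
  constructor
  · ext x x'
    rw [Matrix.sum_apply]
    simp only [Matrix.mul_apply, Matrix.conjTranspose_apply, relabelKraus, Matrix.of_apply]
    rw [Finset.sum_eq_single (k x), Finset.sum_eq_single (h x)]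
    · by_cases hx : x = x'
      · subst hx; simp
      · have : ¬ (h x = h x' ∧ k x' = k x) := fun h' => hx (hinj x x' h'.1 h'.2.symm)
        rw [if_neg this, Matrix.one_apply_ne hx, mul_zero]
    · intro s _ hs
      simp [hs]
    · simp
    · intro j _ hj
      refine Finset.sum_eq_zero fun s _ => ?_
      have : ¬ (s = h x ∧ k x = j) := fun h' => hj h'.2.symm
      rw [if_neg this]
      simp
    · simp
  · intro j ρ hρ
    refine isDiag_mul_mul_conjTranspose ?_ hρ.2.2
    intro x y y' h1 h2
    simp only [relabelKraus, Matrix.of_apply, ne_eq, ite_eq_right_iff, one_ne_zero, imp_false,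
      not_not] at h1 h2
    rw [h1.1, h2.1]

/-- The number of ways in which `w` is a code word of one of the codes `f i`. -/
def codeCount {ι Z Y : Type} [Fintype ι] [Fintype Z] [DecidableEq Y] (f : ι → Z → Y) (w : Y) : ℕ :=
  ∑ i, ∑ y, if f i y = w then 1 else 0

/-- The measurement that projects onto one of the codes `f i` and decodes, or else measures in the
incoherent basis when no code contains the basis vector. -/
noncomputable def codeKraus {ι Z Y : Type} [Fintype ι] [Fintype Z] [DecidableEq Z] [DecidableEq Y]
    (f : ι → Z → Y) (y₀ : Z) : ι ⊕ Y → Matrix Z Y ℂ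
  | .inl i => Matrix.of fun y w => if f i y = w then ((√(codeCount f w))⁻¹ : ℂ) else 0
  | .inr v => Matrix.of fun y w => if (y = y₀ ∧ w = v) ∧ codeCount f w = 0 then 1 else 0

theorem codeKraus_isIncoherentOperation {ι Z Y : Type} [Fintype ι] [Fintype Z] [DecidableEq Z]
    [Fintype Y] [DecidableEq Y] {f : ι → Z → Y} (hf : ∀ i, Function.Injective (f i)) (y₀ : Z) :
    IsIncoherentOperation (codeKraus f y₀) := by
  constructor
  · ext w w'
    rw [Matrix.sum_apply, Fintype.sum_sum_type]
    simp only [Matrix.mul_apply, Matrix.conjTranspose_apply, codeKraus, Matrix.of_apply]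
    by_cases hw : w = w'
    · subst hw
      rw [Matrix.one_apply_eq]
      have h1 : ∑ i, ∑ y, star (if f i y = w then ((√(codeCount f w))⁻¹ : ℂ) else 0) *
          (if f i y = w then ((√(codeCount f w))⁻¹ : ℂ) else 0) =
          (codeCount f w : ℂ) * (codeCount f w : ℂ)⁻¹ := by
        have hsq : ((√(codeCount f w))⁻¹ : ℂ) * ((√(codeCount f w))⁻¹ : ℂ) =
            (codeCount f w : ℂ)⁻¹ := by
          rw [← mul_inv, ← Complex.ofReal_mul, Real.mul_self_sqrt (Nat.cast_nonneg _),
            Complex.ofReal_natCast]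
        have hcount : (codeCount f w : ℂ) = ∑ i, ∑ y, if f i y = w then (1 : ℂ) else 0 := by
          rw [codeCount]
          push_cast
          rfl
        rw [← hsq]
        rw [hcount]
        simp only [Finset.sum_mul]
        refine Finset.sum_congr rfl fun i _ => Finset.sum_congr rfl fun y _ => ?_
        split_ifs
        · rw [Complex.star_def, map_inv₀, Complex.conj_ofReal, one_mul]
        · simp
      have h2 : ∑ v, ∑ y, star (if (y = y₀ ∧ w = v) ∧ codeCount f w = 0 then (1 : ℂ) else 0) *
          (if (y = y₀ ∧ w = v) ∧ codeCount f w = 0 then (1 : ℂ) else 0) =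
          if codeCount f w = 0 then 1 else 0 := by
        rw [Finset.sum_eq_single w, Finset.sum_eq_single y₀]
        · split_ifs <;> simp_all
        · intro y _ hy; simp [hy]
        · simp
        · intro v _ hv
          exact Finset.sum_eq_zero fun y _ => by simp [hv.symm]
        · simp
      rw [h1, h2]
      split_ifs with h
      · simp [h]
      · have : (codeCount f w : ℂ) ≠ 0 := by exact_mod_cast h
        rw [mul_inv_cancel₀ this, add_zero]
    · rw [Matrix.one_apply_ne hw]
      rw [Finset.sum_eq_zero, Finset.sum_eq_zero, add_zero]
      · intro v _
        refine Finset.sum_eq_zero fun y _ => ?_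
        by_cases h : w = v
        · have : w' ≠ v := fun h' => hw (h.trans h'.symm)
          simp [this]
        · simp [h]
      · intro i _
        refine Finset.sum_eq_zero fun y _ => ?_
        by_cases h : f i y = w
        · have : f i y ≠ w' := fun h' => hw (h.symm.trans h')
          simp [this]
        · simp [h]
  · intro i ρ hρ
    refine isDiag_mul_mul_conjTranspose ?_ hρ.2.2
    intro w y y' h1 h2
    rcases i with i | v
    · simp only [codeKraus, Matrix.of_apply, ne_eq, ite_eq_right_iff, Classical.not_imp] at h1 h2
      exact hf i (h1.1.trans h2.1.symm)
    · simp only [codeKraus, Matrix.of_apply, ne_eq, ite_eq_right_iff, Classical.not_imp] at h1 h2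
      exact h1.1.1.1.trans h2.1.1.1.symm

/-! ### A two-step protocol -/

theorem kronecker_mulVec_apply {A B A' B' : Type} [Fintype A] [Fintype B] (M : Matrix A' A ℂ)
    (N : Matrix B' B ℂ) (ψ : A × B → ℂ) (a : A') (b : B') :
    ((M ⊗ₖ N) *ᵥ ψ) (a, b) = ∑ x, ∑ w, M a x * N b w * ψ (x, w) := by
  simp only [Matrix.mulVec, dotProduct, Fintype.sum_prod_type, Matrix.kroneckerMap_apply]

theorem IsLIOCC.trace_density {A' B' : Type} [Fintype A'] [DecidableEq A'] [Fintype B']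
    [DecidableEq B'] {A B : Type} [Fintype A] [DecidableEq A] [Fintype B] [DecidableEq B]
    {L : Matrix (A × B) (A × B) ℂ → Matrix (A' × B') (A' × B') ℂ} (hL : IsLIOCC L)
    (ψ : A × B → ℂ) : (L (density ψ)).trace = ((vecNorm ψ ^ 2 : ℝ) : ℂ) := by
  obtain ⟨κ, _, M, N, h1, h2⟩ := hL.exists_kraus
  rw [h1, Matrix.trace_sum]
  simp only [mul_density_mul_conjTranspose, Liocc.trace_density]
  rw [← sum_vecNorm_sq_kraus h2 ψ]
  push_cast
  rfl

theorem density_smul {X : Type} (c : ℂ) (φ : X → ℂ) :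
    density (c • φ) = ((‖c‖ ^ 2 : ℝ) : ℂ) • density φ := by
  ext x y
  simp only [density, Matrix.vecMulVec_apply, Pi.smul_apply, Pi.star_apply, smul_eq_mul, star_mul,
    Matrix.smul_apply]
  push_cast
  rw [← Complex.mul_conj', Complex.star_def]
  ring

/-- The trace distance between a pure state and a mixture that mostly consists of a nearby pure
state. -/
theorem traceDistance_mixture_le {X κ : Type} [Fintype X] [DecidableEq X] [Fintype κ]
    {φ Λ : X → ℂ} (hφ : vecNorm φ = 1) (hΛ : vecNorm Λ = 1) {s : ℝ} (v : κ → X → ℂ)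
    (hs : s + ∑ k, vecNorm (v k) ^ 2 = 1) :
    traceDistance ((s : ℂ) • density φ + ∑ k, density (v k)) (density Λ) ≤
      ∑ k, vecNorm (v k) ^ 2 + vecNorm (φ - Λ) := by
  set f := ∑ k, vecNorm (v k) ^ 2 with hf
  have hf0 : 0 ≤ f := Finset.sum_nonneg fun k _ => sq_nonneg _
  let x : Fin 3 ⊕ κ → X → ℂ := Sum.elim ![-(f : ℂ) • φ, φ, φ - Λ] v
  let y : Fin 3 ⊕ κ → X → ℂ := Sum.elim ![φ, φ - Λ, Λ] v
  have h1 : (s : ℂ) • density φ + ∑ k, density (v k) - density Λ =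
      ∑ k, Matrix.vecMulVec (x k) (star (y k)) := by
    rw [Fintype.sum_sum_type, Fin.sum_univ_three]
    have hs' : (s : ℂ) = 1 - f := by
      rw [eq_sub_iff_add_eq]; exact_mod_cast hs
    ext a b
    simp only [x, y, Sum.elim_inl, Sum.elim_inr, hs', density, Matrix.sub_apply, Matrix.add_apply,
      Matrix.smul_apply, Matrix.vecMulVec_apply, Matrix.cons_val_zero, Matrix.cons_val_one,
      Matrix.cons_val, Pi.smul_apply, Pi.star_apply, Pi.sub_apply, star_sub, smul_eq_mul]
    ring
  rw [traceDistance]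
  have h2 := traceNorm_sum_vecMulVec_le x y
  rw [Fintype.sum_sum_type (fun k => vecNorm (x k) * vecNorm (y k)), Fin.sum_univ_three,
    ← h1] at h2
  simp only [x, y, Sum.elim_inl, Sum.elim_inr, Matrix.cons_val_zero, Matrix.cons_val_one,
      Matrix.cons_val, vecNorm_smul, hφ, hΛ, norm_neg, Complex.norm_real, ← sq, ← hf,
      Real.norm_of_nonneg hf0] at h2
  linarith

/-- One party projects onto one of several codes `f i`, the other party relabels its basis
according to the outcome. If all resulting states are proportional to `φ`, this approximates
every state near `φ`. -/
theorem exists_protocol {X Y Z S ι κ : Type} [Fintype X] [DecidableEq X] [Fintype Y] [DecidableEq Y]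
    [Fintype Z] [DecidableEq Z] [Fintype S] [DecidableEq S] [Fintype ι] [Fintype κ] [DecidableEq κ]
    {ψ : X × Y → ℂ} (hψ : IsPureState ψ) {f : ι → Z → Y} (hf : ∀ i, Function.Injective (f i))
    (y₀ : Z) (s₀ : S) {h : ι → X → S} {k : ι → X → κ}
    (hinj : ∀ i x x', h i x = h i x' → k i x = k i x' → x = x') {φ Λ : S × Z → ℂ}
    (hφ : vecNorm φ = 1) (hΛ : vecNorm Λ = 1) (c : ι → κ → ℂ)
    (hout : ∀ i j s y, ((√(codeCount f (f i y)))⁻¹ : ℂ) *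
      (∑ x, if s = h i x ∧ k i x = j then ψ (x, f i y) else 0) = c i j * φ (s, y)) :
    ∃ L : Matrix (X × Y) (X × Y) ℂ → Matrix (S × Z) (S × Z) ℂ, IsLIOCC L ∧
      traceDistance (L (density ψ)) (density Λ) ≤
        ∑ w with codeCount f w = 0, ∑ x, ‖ψ (x, w)‖ ^ 2 + vecNorm (φ - Λ) := by
  let Rfail : X → Matrix S X ℂ := relabelKraus (fun _ => s₀) id
  let N : ι ⊕ Y → Matrix (X × Z) (X × Z) ℂ → Matrix (S × Z) (S × Z) ℂ := fun i ρ =>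
    Sum.elim
      (fun i => ∑ j, (relabelKraus (h i) (k i) j ⊗ₖ (1 : Matrix Z Z ℂ)) * ρ *
        (relabelKraus (h i) (k i) j ⊗ₖ (1 : Matrix Z Z ℂ))ᴴ)
      (fun _ => ∑ x, (Rfail x ⊗ₖ (1 : Matrix Z Z ℂ)) * ρ *
        (Rfail x ⊗ₖ (1 : Matrix Z Z ℂ))ᴴ) i
  let L : Matrix (X × Y) (X × Y) ℂ → Matrix (S × Z) (S × Z) ℂ := fun ρ =>
    ∑ i, N i (((1 : Matrix X X ℂ) ⊗ₖ codeKraus f y₀ i) * ρ *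
      ((1 : Matrix X X ℂ) ⊗ₖ codeKraus f y₀ i)ᴴ)
  have hL : IsLIOCC L := by
    refine IsLIOCC.bob _ (codeKraus_isIncoherentOperation hf y₀) N ?_
    rintro (i | v)
    · exact IsLIOCC.alice _ (relabelKraus_isIncoherentOperation (hinj i)) (fun _ ρ => ρ)
        fun _ => IsLIOCC.done
    · exact IsLIOCC.alice _ (relabelKraus_isIncoherentOperation (h := fun _ => s₀) (k := id)
        (fun x x' _ h => h)) (fun _ ρ => ρ) fun _ => IsLIOCC.done
  let fail : Y × X → S × Z → ℂ := fun q =>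
    (if codeCount f q.1 = 0 then ψ (q.2, q.1) else 0) • Pi.single (s₀, y₀) 1
  have hval : L (density ψ) = ((∑ i, ∑ j, ‖c i j‖ ^ 2 : ℝ) : ℂ) • density φ +
      ∑ q, density (fail q) := by
    simp only [L, N]
    rw [Fintype.sum_sum_type]
    simp only [Sum.elim_inl, Sum.elim_inr, mul_density_mul_conjTranspose, Matrix.mulVec_mulVec,
      ← Matrix.mul_kronecker_mul, Matrix.one_mul, Matrix.mul_one]
    congr 1
    · push_cast
      simp only [Finset.sum_smul]
      refine Finset.sum_congr rfl fun i _ => Finset.sum_congr rfl fun j _ => ?_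
      have : (relabelKraus (h i) (k i) j ⊗ₖ codeKraus f y₀ (Sum.inl i)) *ᵥ ψ = c i j • φ := by
        ext ⟨s, y⟩
        rw [kronecker_mulVec_apply, Pi.smul_apply, smul_eq_mul, ← hout, Finset.mul_sum]
        refine Finset.sum_congr rfl fun x _ => ?_
        rw [Finset.sum_eq_single (f i y)]
        · simp only [relabelKraus, codeKraus, Matrix.of_apply, if_true]
          split_ifs <;> simp
        · intro w _ hw
          simp [codeKraus, hw.symm]
        · simp
      rw [this, density_smul]
      push_cast
      rfl
    · rw [Fintype.sum_prod_type]
      refine Finset.sum_congr rfl fun v _ => Finset.sum_congr rfl fun x _ => congrArg density ?_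
      ext ⟨s, y⟩
      rw [kronecker_mulVec_apply, Finset.sum_eq_single x, Finset.sum_eq_single v]
      · simp only [Rfail, relabelKraus, codeKraus, Matrix.of_apply, fail, Pi.smul_apply,
          Pi.single_apply, Prod.mk.injEq, smul_eq_mul, id]
        by_cases h1 : s = s₀ <;> by_cases h2 : y = y₀ <;> by_cases h3 : codeCount f v = 0 <;>
          simp [h1, h2, h3]
      · intro w _ hw
        simp [codeKraus, hw]
      · simp
      · intro x' _ hx
        simp [Rfail, relabelKraus, hx]
      · simp
  have hfail : ∑ q, vecNorm (fail q) ^ 2 =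
      ∑ w with codeCount f w = 0, ∑ x, ‖ψ (x, w)‖ ^ 2 := by
    rw [Fintype.sum_prod_type, Finset.sum_filter]
    refine Finset.sum_congr rfl fun w _ => ?_
    have h1 : vecNorm (Pi.single (s₀, y₀) (1 : ℂ)) = 1 := by
      rw [vecNorm, PiLp.toLp_single]; simp
    simp only [fail, vecNorm_smul, h1, mul_one]
    split_ifs <;> simp
  have hs : (∑ i, ∑ j, ‖c i j‖ ^ 2) + ∑ q, vecNorm (fail q) ^ 2 = 1 := by
    apply Complex.ofReal_injective
    have h1 := hL.trace_density ψ
    rw [hval, hψ.vecNorm_eq, Matrix.trace_add, Matrix.trace_smul, Matrix.trace_sum] at h1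
    simp only [Liocc.trace_density, hφ] at h1
    push_cast at h1 ⊢
    simpa using h1
  refine ⟨L, hL, ?_⟩
  rw [hval, ← hfail]
  exact traceDistance_mixture_le hφ hΛ fail hs

/-! ### Nearly orthonormal families and maximally entangled states -/

/-- A family of vectors, the columns of `W`, whose Gram matrix `G` after a projection `Q` is close
to the identity is close to an orthonormal family. -/
theorem exists_isometry_near {D Z : Type} [Fintype D] [DecidableEq D] [Fintype Z] [DecidableEq Z]
    {W : Matrix D Z ℂ} {Q : Matrix D D ℂ} (hQ1 : Qᴴ = Q) (hQ2 : Q * Q = Q) {G : Matrix Z Z ℂ}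
    (hG : G = Wᴴ * Q * W) :
    ∃ V : Matrix (D ⊕ Z) Z ℂ, Vᴴ * V = 1 ∧
      Fintype.card Z + (G - 1).trace.re / 2 - (∑ i, ∑ j, ‖(G - 1) i j‖ ^ 2) / 2 ≤
        (∑ u, ∑ y, star (V (Sum.inl u) y) * W u y).re := by
  have hGpsd : G.PosSemidef := by
    have : G = (Q * W)ᴴ * (Q * W) := by
      rw [hG, Matrix.conjTranspose_mul, hQ1, Matrix.mul_assoc, Matrix.mul_assoc, ← Matrix.mul_assoc Q,
        hQ2]
    rw [this]
    exact Matrix.posSemidef_conjTranspose_mul_self _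
  have hGh : Gᴴ = G := hGpsd.1
  have hpd : (1 + G).PosDef := Matrix.PosDef.one.add_posSemidef hGpsd
  set J := (1 + G)⁻¹ with hJ
  have hdet : IsUnit (1 + G).det := (Matrix.isUnit_iff_isUnit_det _).mp hpd.isUnit
  have hJ1 : J * (1 + G) = 1 := Matrix.nonsing_inv_mul _ hdet
  have hJ2 : (1 + G) * J = 1 := Matrix.mul_nonsing_inv _ hdet
  have hJh : Jᴴ = J := by rw [hJ, Matrix.conjTranspose_nonsing_inv]; simp [hGh]
  have hGJ : G * J = 1 - J := by
    rw [eq_sub_iff_add_eq, add_comm]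
    simpa [Matrix.add_mul] using hJ2
  have hJG : J * G = 1 - J := by
    rw [eq_sub_iff_add_eq, add_comm]
    simpa [Matrix.mul_add] using hJ1
  let Y : Matrix D Z ℂ := (2 : ℂ) • (Q * W * J)
  have hYY : Yᴴ * Y = (4 : ℂ) • (J * G * J) := by
    simp only [Y, Matrix.conjTranspose_smul, Matrix.conjTranspose_mul, hQ1, hJh,
      Matrix.smul_mul, Matrix.mul_smul, smul_smul]
    have : J * (Wᴴ * Q) * (Q * W * J) = J * G * J := by
      rw [hG]
      calc J * (Wᴴ * Q) * (Q * W * J) = J * (Wᴴ * (Q * Q) * W) * J := by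
            simp only [Matrix.mul_assoc]
        _ = _ := by rw [hQ2]
    rw [this]
    norm_num
  have hYW : Yᴴ * W = (2 : ℂ) • (1 - J) := by
    simp only [Y, Matrix.conjTranspose_smul, Matrix.conjTranspose_mul, hQ1, hJh,
      Matrix.smul_mul]
    have : J * (Wᴴ * Q) * W = J * G := by rw [hG]; simp only [Matrix.mul_assoc]
    rw [this, hJG]
    norm_num
  refine ⟨Matrix.fromRows Y ((1 - G) * J), ?_, ?_⟩
  · rw [Matrix.conjTranspose_fromRows_eq_fromCols_conjTranspose, Matrix.fromCols_mul_fromRows, hYY,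
      Matrix.conjTranspose_mul, hJh, Matrix.conjTranspose_sub, hGh, Matrix.conjTranspose_one]
    have h1 : J * (1 - G) = (2 : ℂ) • J - 1 := by
      rw [Matrix.mul_sub, hJG, Matrix.mul_one, two_smul]; abel
    have h2 : (1 - G) * J = (2 : ℂ) • J - 1 := by
      rw [Matrix.sub_mul, hGJ, Matrix.one_mul, two_smul]; abel
    rw [h1, h2, hJG, Matrix.sub_mul, Matrix.sub_mul, Matrix.mul_sub]
    simp only [Matrix.one_mul, Matrix.mul_one, smul_sub, Matrix.smul_mul, Matrix.mul_smul]
    ext i j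
    simp only [Matrix.add_apply, Matrix.sub_apply, Matrix.smul_apply, smul_eq_mul]
    ring
  · have htr : ∑ u, ∑ y, star (Matrix.fromRows Y ((1 - G) * J) (Sum.inl u) y) * W u y =
        (Yᴴ * W).trace := by
      simp only [Matrix.fromRows_apply_inl, Matrix.trace, Matrix.diag_apply, Matrix.mul_apply,
        Matrix.conjTranspose_apply]
      rw [Finset.sum_comm]
    set H := G - 1 with hH
    have hHh : Hᴴ = H := by rw [hH, Matrix.conjTranspose_sub, hGh, Matrix.conjTranspose_one]
    have hpsd : (1 - J).PosSemidef := by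
      have h1 : 1 - J = Jᴴ * (G + Gᴴ * G) * J := by
        rw [hJh, hGh]
        calc 1 - J = J * G := hJG.symm
          _ = J * G * ((1 + G) * J) := by rw [hJ2, Matrix.mul_one]
          _ = _ := by simp only [Matrix.mul_add, Matrix.add_mul, Matrix.one_mul,
                        Matrix.mul_assoc]
      rw [h1]
      exact (hGpsd.add (Matrix.posSemidef_conjTranspose_mul_self G)).conjTranspose_mul_mul_same J
    have hHJ : 0 ≤ ((H * (1 - J) * H).trace).re := by
      have h1 := (hpsd.conjTranspose_mul_mul_same H).trace_nonneg
      rw [hHh] at h1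
      exact (Complex.le_def.mp h1).1
    have hHJH : H * (1 - J) * H = H * H - (4 : ℂ) • J + (2 : ℂ) • 1 - H := by
      have h1 : J * H = 1 - (2 : ℂ) • J := by
        rw [hH, Matrix.mul_sub, hJG, Matrix.mul_one, two_smul]; abel
      have h2 : H * J = 1 - (2 : ℂ) • J := by
        rw [hH, Matrix.sub_mul, hGJ, Matrix.one_mul, two_smul]; abel
      calc H * (1 - J) * H = H * H - H * J * H := by
            rw [Matrix.mul_sub H, Matrix.mul_one, Matrix.sub_mul (H) (H * J)]
        _ = H * H - (H - (2 : ℂ) • (1 - (2 : ℂ) • J)) := by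
            rw [h2, Matrix.sub_mul 1 _ H, Matrix.one_mul, Matrix.smul_mul, h1]
        _ = _ := by
            rw [smul_sub, smul_smul]
            norm_num
            abel
    rw [htr, hYW]
    have hHH : (∑ i, ∑ j, ‖H i j‖ ^ 2) = ((H * H).trace).re := by
      have := sum_norm_sq_eq_trace H
      rw [hHh] at this
      rw [← this, Complex.ofReal_re]
    rw [hHJH] at hHJ
    simp only [Matrix.trace_sub, Matrix.trace_add, Matrix.trace_smul, Matrix.trace_one,
      smul_eq_mul, Complex.sub_re, Complex.add_re, Complex.mul_re, Complex.re_ofNat,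
      Complex.im_ofNat, zero_mul, sub_zero, Complex.natCast_re] at hHJ ⊢
    rw [hHH]
    linarith

/-- The columns of an isometry, paired with the incoherent basis, form a maximally entangled
state. -/
theorem isMaximallyEntangled_of_isometry {S : Type} [Fintype S] [DecidableEq S] {M : ℕ} (hM : 0 < M)
    {V : Matrix S (Fin M) ℂ} (hV : Vᴴ * V = 1) :
    IsMaximallyEntangled M fun q : S × Fin M => ((√M)⁻¹ : ℂ) * V q.1 q.2 := by
  set φ : S × Fin M → ℂ := fun q => ((√M)⁻¹ : ℂ) * V q.1 q.2 with hφ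
  have hsq : ((√M)⁻¹ : ℂ) * ((√M)⁻¹ : ℂ) = (M : ℂ)⁻¹ := by
    rw [← mul_inv, ← Complex.ofReal_mul, Real.mul_self_sqrt (Nat.cast_nonneg _),
      Complex.ofReal_natCast]
  have hM' : (M : ℂ) ≠ 0 := by exact_mod_cast hM.ne'
  have hcoeff : coeffMatrix φ = ((√M)⁻¹ : ℂ) • V := rfl
  have hA : coeffMatrix φ * (coeffMatrix φ)ᴴ = (M : ℂ)⁻¹ • (V * Vᴴ) := by
    rw [hcoeff, Matrix.conjTranspose_smul, Matrix.smul_mul, Matrix.mul_smul, smul_smul,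
      Complex.star_def, map_inv₀, Complex.conj_ofReal, hsq]
  have hrank : V.rank = M := by
    rw [← Matrix.rank_conjTranspose_mul_self, hV, Matrix.rank_one, Fintype.card_fin]
  refine ⟨?_, V * Vᴴ, 1, ⟨?_, ?_⟩, ?_, IsStarProjection.one _, ?_, ?_, ?_⟩
  · apply Complex.ofReal_injective
    have h1 := sum_norm_sq_eq_trace (coeffMatrix φ)
    rw [hA, Matrix.trace_smul, Matrix.trace_mul_comm, hV, Matrix.trace_one, Fintype.card_fin,
      ← vecNorm_sq_eq_sum_coeffMatrix, vecNorm_sq, smul_eq_mul, inv_mul_cancel₀ hM'] at h1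
    rw [h1, Complex.ofReal_one]
  · change V * Vᴴ * (V * Vᴴ) = V * Vᴴ
    rw [Matrix.mul_assoc, ← Matrix.mul_assoc Vᴴ, hV, Matrix.one_mul]
  · change (V * Vᴴ)ᴴ = V * Vᴴ
    rw [Matrix.conjTranspose_mul, Matrix.conjTranspose_conjTranspose]
  · rw [Matrix.rank_self_mul_conjTranspose, hrank]
  · rw [Matrix.rank_one, Fintype.card_fin]
  · rw [reducedA_density, hA]
  · ext y y'
    have h1 : (Vᴴ * V) y' y = (1 : Matrix (Fin M) (Fin M) ℂ) y' y := by rw [hV]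
    rw [Matrix.mul_apply] at h1
    simp only [Matrix.conjTranspose_apply] at h1
    simp only [reducedB, density, Matrix.of_apply, Matrix.vecMulVec_apply, Pi.star_apply, hφ,
      Matrix.smul_apply, smul_eq_mul, star_mul']
    have h2 : (1 : Matrix (Fin M) (Fin M) ℂ) y y' = (1 : Matrix (Fin M) (Fin M) ℂ) y' y := by
      simp [Matrix.one_apply, eq_comm]
    rw [h2, ← h1, Finset.mul_sum, ← hsq]
    refine Finset.sum_congr rfl fun s _ => ?_
    rw [Complex.star_def, map_inv₀, Complex.conj_ofReal]
    ring

/-- The squared distance of unit vectors with given overlap. -/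
theorem vecNorm_sub_sq {X : Type} [Fintype X] {φ χ : X → ℂ} (hφ : vecNorm φ = 1)
    (hχ : vecNorm χ = 1) : vecNorm (φ - χ) ^ 2 = 2 - 2 * (star χ ⬝ᵥ φ).re := by
  apply Complex.ofReal_injective
  have h2 : star φ ⬝ᵥ χ = star (star χ ⬝ᵥ φ) := Matrix.star_dotProduct _ _
  rw [← star_dotProduct_self, star_sub, sub_dotProduct, dotProduct_sub, dotProduct_sub, h2,
    star_dotProduct_self, star_dotProduct_self, hφ, hχ, Complex.star_def]
  have h3 := Complex.add_conj (star χ ⬝ᵥ φ)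
  push_cast at h3 ⊢
  linear_combination -h3

/-! ### Greedy selection of a nearly orthonormal code -/

/-- From a finite family of vectors with small frame bound one can choose `M` members such that each
has small overlap with its predecessors. -/
theorem exists_greedy {T D : Type} [Fintype D] (s : Finset T) (hs : s.Nonempty) (v : T → D → ℂ)
    {κ γ : ℝ} (hκ : 0 ≤ κ) (hv1 : ∀ x ∈ s, vecNorm (v x) ≤ 1)
    (hframe : ∀ u : D → ℂ, ∑ x ∈ s, ‖star u ⬝ᵥ v x‖ ^ 2 ≤ κ * s.card * vecNorm u ^ 2) (M : ℕ)
    (hM : (M - 1 : ℝ) * κ ≤ γ) :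
    ∃ c : Fin M → T, (∀ y, c y ∈ s) ∧
      ∀ y, ∑ j with j < y, ‖star (v (c j)) ⬝ᵥ v (c y)‖ ^ 2 ≤ γ := by
  induction M with
  | zero => exact ⟨Fin.elim0, fun y => y.elim0, fun y => y.elim0⟩
  | succ M ih =>
    obtain ⟨c, hc1, hc2⟩ := ih (le_trans (by push_cast; nlinarith) hM)
    have hcard : (0 : ℝ) < s.card := by exact_mod_cast hs.card_pos
    obtain ⟨x, hx, hxle⟩ : ∃ x ∈ s, ∑ j, ‖star (v (c j)) ⬝ᵥ v x‖ ^ 2 ≤ γ := by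
      by_contra! hcon
      have h1 : ∑ x ∈ s, γ < ∑ x ∈ s, ∑ j, ‖star (v (c j)) ⬝ᵥ v x‖ ^ 2 :=
        Finset.sum_lt_sum_of_nonempty hs hcon
      rw [Finset.sum_comm, Finset.sum_const, nsmul_eq_mul] at h1
      have h2 : ∑ j : Fin M, ∑ x ∈ s, ‖star (v (c j)) ⬝ᵥ v x‖ ^ 2 ≤
          ∑ _j : Fin M, κ * s.card := by
        refine Finset.sum_le_sum fun j _ => (hframe _).trans ?_
        refine mul_le_of_le_one_right (by positivity) ?_
        have := hv1 _ (hc1 j)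
        nlinarith [vecNorm_nonneg (v (c j))]
      simp only [Finset.sum_const, Finset.card_univ, Fintype.card_fin, nsmul_eq_mul] at h2
      push_cast at hM
      nlinarith
    refine ⟨Fin.snoc (α := fun _ => T) c x, ?_, ?_⟩
    · intro y
      refine Fin.lastCases ?_ (fun i => ?_) y
      · simpa using hx
      · simpa using hc1 i
    · intro y
      refine Fin.lastCases ?_ (fun i => ?_) y
      · rw [Finset.sum_filter, Fin.sum_univ_castSucc]
        simpa [Fin.castSucc_lt_last] using hxle
      · rw [Finset.sum_filter, Fin.sum_univ_castSucc]
        have := hc2 i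
        rw [Finset.sum_filter] at this
        simpa [Fin.castSucc_lt_castSucc_iff, (Fin.castSucc_lt_last i).le.not_gt] using this

/-- The Gram matrix of a greedily chosen code is close to the identity, and the code has no
repetitions. -/
theorem gram_sub_one_le {D : Type} [Fintype D] {M : ℕ} {v : Fin M → D → ℂ} {η γ : ℝ}
    (hv1 : ∀ y, vecNorm (v y) ≤ 1) (hv2 : ∀ y, 1 - η ≤ vecNorm (v y) ^ 2)
    (hγ : ∀ y, ∑ j with j < y, ‖star (v j) ⬝ᵥ v y‖ ^ 2 ≤ γ) :
    ∑ i, ∑ j, ‖(star (v i) ⬝ᵥ v j - (1 : Matrix (Fin M) (Fin M) ℂ) i j)‖ ^ 2 ≤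
      M * (η ^ 2 + 2 * γ) := by
  have hsym : ∀ i j, ‖star (v i) ⬝ᵥ v j‖ ^ 2 = ‖star (v j) ⬝ᵥ v i‖ ^ 2 := fun i j => by
    rw [Matrix.star_dotProduct (v i) (v j), norm_star]
  have hsplit : ∀ i j, ‖(star (v i) ⬝ᵥ v j - (1 : Matrix (Fin M) (Fin M) ℂ) i j)‖ ^ 2 ≤
      (if i = j then η ^ 2 else 0) + (if i < j then ‖star (v i) ⬝ᵥ v j‖ ^ 2 else 0) +
        (if j < i then ‖star (v j) ⬝ᵥ v i‖ ^ 2 else 0) := by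
    intro i j
    rcases lt_trichotomy i j with h | h | h
    · simp [h.ne, h, h.not_gt]
    · subst h
      rw [star_dotProduct_self, Matrix.one_apply_eq]
      simp only [lt_irrefl, if_true, if_false, add_zero]
      rw [← Complex.ofReal_one, ← Complex.ofReal_sub, Complex.norm_real, Real.norm_eq_abs, sq_abs]
      have h1 := hv1 i
      have h2 := hv2 i
      have h3 : vecNorm (v i) ^ 2 ≤ 1 := by nlinarith [vecNorm_nonneg (v i)]
      nlinarith
    · simp [h.ne', h, h.not_gt, hsym i j]
  calc _ ≤ ∑ i, ∑ j, _ := Finset.sum_le_sum fun i _ => Finset.sum_le_sum fun j _ => hsplit i j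
    _ = ∑ i : Fin M, η ^ 2 + ∑ j, ∑ i with i < j, ‖star (v i) ⬝ᵥ v j‖ ^ 2 +
        ∑ i, ∑ j with j < i, ‖star (v j) ⬝ᵥ v i‖ ^ 2 := by
      simp only [Finset.sum_add_distrib, Finset.sum_ite_eq, Finset.mem_univ, if_true,
        Finset.sum_filter]
      congr 2
      exact Finset.sum_comm
    _ ≤ ∑ i : Fin M, η ^ 2 + ∑ _j : Fin M, γ + ∑ _i : Fin M, γ := by
      gcongr with j _ i _
      · exact hγ j
      · exact hγ i
    _ = _ := by simp; ring

theorem injective_of_greedy {T D : Type} [Fintype D] {M : ℕ} {v : T → D → ℂ} {c : Fin M → T}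
    {η γ : ℝ} (hη : η ≤ 1) (hv2 : ∀ y, 1 - η ≤ vecNorm (v (c y)) ^ 2)
    (hγ : ∀ y, ∑ j with j < y, ‖star (v (c j)) ⬝ᵥ v (c y)‖ ^ 2 ≤ γ) (hηγ : γ < (1 - η) ^ 2) :
    Function.Injective c := by
  have key : ∀ i j, i < j → c i ≠ c j := by
    intro i j hij h
    have h1 : ‖star (v (c i)) ⬝ᵥ v (c j)‖ ^ 2 ≤ γ :=
      (Finset.single_le_sum (f := fun i => ‖star (v (c i)) ⬝ᵥ v (c j)‖ ^ 2)
        (fun _ _ => sq_nonneg _) (by simpa using hij)).trans (hγ j)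
    rw [h, star_dotProduct_self, Complex.norm_real, Real.norm_of_nonneg (sq_nonneg _)] at h1
    have h2 := pow_le_pow_left₀ (by linarith) (hv2 j) 2
    linarith
  intro i j h
  rcases lt_trichotomy i j with hij | hij | hij
  · exact absurd h (key i j hij)
  · exact hij
  · exact absurd h.symm (key j i hij)

/-! ### Letter counts of words -/

/-- The number of occurrences of the letter `b` in the word `w`. -/
def letterCount {I B : Type} [Fintype I] [DecidableEq B] (w : I → B) (b : B) : ℕ :=
  Fintype.card {i // w i = b}

theorem exists_embedding_of_letterCount_le {I K B : Type} [Fintype I] [Fintype K] [DecidableEq B]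
    {c : I → B} {w : K → B} (h : ∀ b, letterCount c b ≤ letterCount w b) :
    ∃ j : I ↪ K, ∀ i, w (j i) = c i := by
  have h1 : ∀ b, Nonempty ({i // c i = b} ↪ {k // w k = b}) := fun b =>
    Function.Embedding.nonempty_of_card_le (h b)
  let e : ∀ b, {i // c i = b} ↪ {k // w k = b} := fun b => (h1 b).some
  let j : I ↪ K := (Equiv.sigmaFiberEquiv c).symm.toEmbedding.trans
    ((Function.Embedding.sigmaMap (Function.Embedding.refl B) e).trans
      (Equiv.sigmaFiberEquiv w).toEmbedding)
  exact ⟨j, fun i => (e (c i) ⟨i, rfl⟩).2⟩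

theorem exists_perm_of_letterCount_eq {I B : Type} [Fintype I] [DecidableEq B]
    {c w : I → B} (h : ∀ b, letterCount c b = letterCount w b) :
    ∃ π : Equiv.Perm I, c = w ∘ π := by
  obtain ⟨j, hj⟩ := exists_embedding_of_letterCount_le fun b => (h b).le
  exact ⟨Equiv.ofBijective j (Finite.injective_iff_bijective.mp j.injective),
    funext fun i => (hj i).symm⟩

theorem exists_equiv_extending {m r : ℕ} (j : Fin m ↪ Fin (m + r)) :
    ∃ τ : Fin (m + r) ≃ Fin m ⊕ Fin r, ∀ i, τ.symm (Sum.inl i) = j i := by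
  classical
  have hcard : Fintype.card ((Set.range j)ᶜ : Set (Fin (m + r))) = r := by
    rw [Fintype.card_compl_set, Set.card_range_of_injective j.injective]
    simp
  let glue : Fin m ⊕ Fin r ≃ Fin (m + r) :=
    (Equiv.sumCongr (Equiv.ofInjective j j.injective)
      (Fintype.equivFinOfCardEq hcard).symm).trans (Equiv.Set.sumCompl (Set.range j))
  exact ⟨glue.symm, fun i => by simp [glue]⟩

/-! ### Codes of constant letter counts -/

/-- The code whose words are those of `c`, extended by `z` and rearranged by `τ`. -/
def arrangedCode {m r : ℕ} {Z B : Type} (c : Z → Fin m → B)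
    (q : (Fin (m + r) ≃ Fin m ⊕ Fin r) × (Fin r → B)) (y : Z) : Fin (m + r) → B :=
  Sum.elim (c y) q.2 ∘ q.1

theorem arrangedCode_injective {m r : ℕ} {Z B : Type} {c : Z → Fin m → B}
    (hc : Function.Injective c) (q : (Fin (m + r) ≃ Fin m ⊕ Fin r) × (Fin r → B)) :
    Function.Injective (arrangedCode c q) := by
  intro y y' h
  apply hc
  ext i
  have := congrFun h (q.1.symm (Sum.inl i))
  simpa [arrangedCode] using this

theorem codeCount_arrangedCode_comp {m r : ℕ} {Z B : Type} [Fintype Z] [Fintype B] [DecidableEq B]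
    (c : Z → Fin m → B) (w : Fin (m + r) → B) (σ : Equiv.Perm (Fin (m + r))) :
    codeCount (arrangedCode (r := r) c) (w ∘ σ) = codeCount (arrangedCode (r := r) c) w := by
  rw [codeCount, codeCount, Fintype.sum_prod_type, Fintype.sum_prod_type]
  refine (Fintype.sum_equiv (Equiv.equivCongr σ (Equiv.refl _)) _ _ fun τ => ?_)
  refine Finset.sum_congr rfl fun z _ => Finset.sum_congr rfl fun y _ => ?_
  have : arrangedCode c (τ, z) y = w ∘ σ ↔
      arrangedCode c ((Equiv.equivCongr σ (Equiv.refl _)) τ, z) y = w := by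
    constructor
    · intro h
      ext k
      have := congrFun h (σ.symm k)
      simpa [arrangedCode] using this
    · intro h
      ext k
      have := congrFun h (σ k)
      simpa [arrangedCode] using this
  simp only [this]

theorem codeCount_arrangedCode_eq {m r : ℕ} {Z B : Type} [Fintype Z] [Fintype B] [DecidableEq B]
    {c : Z → Fin m → B} (hc : ∀ y y' b, letterCount (c y) b = letterCount (c y') b)
    (q : (Fin (m + r) ≃ Fin m ⊕ Fin r) × (Fin r → B)) (y y' : Z) :
    codeCount (arrangedCode (r := r) c) (arrangedCode c q y) =
      codeCount (arrangedCode (r := r) c) (arrangedCode c q y') := by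
  obtain ⟨π, hπ⟩ := exists_perm_of_letterCount_eq (hc y y')
  let σ : Equiv.Perm (Fin (m + r)) :=
    (q.1.trans (Equiv.sumCongr π (Equiv.refl _))).trans q.1.symm
  have : arrangedCode c q y = arrangedCode c q y' ∘ σ := by
    ext k
    simp only [arrangedCode, σ, Function.comp_apply, Equiv.trans_apply, Equiv.apply_symm_apply, hπ]
    cases q.1 k <;> simp
  rw [this, codeCount_arrangedCode_comp]

theorem codeCount_arrangedCode_ne_zero {m r : ℕ} {Z B : Type} [Fintype Z] [Fintype B]
    [DecidableEq B] (c : Z → Fin m → B) (y : Z) {w : Fin (m + r) → B}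
    (h : ∀ b, letterCount (c y) b ≤ letterCount w b) :
    codeCount (arrangedCode (r := r) c) w ≠ 0 := by
  obtain ⟨j, hj⟩ := exists_embedding_of_letterCount_le h
  obtain ⟨τ, hτ⟩ := exists_equiv_extending j
  have hw : arrangedCode c (τ, fun i => w (τ.symm (Sum.inr i))) y = w := by
    ext k
    obtain ⟨s, rfl⟩ := τ.symm.surjective k
    rcases s with i | i
    · rw [arrangedCode, Function.comp_apply, Equiv.apply_symm_apply, Sum.elim_inl, hτ, hj]
    · simp [arrangedCode]
  intro h0
  rw [codeCount, Finset.sum_eq_zero_iff] at h0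
  have h1 := h0 (τ, fun i => w (τ.symm (Sum.inr i))) (Finset.mem_univ _)
  rw [Finset.sum_eq_zero_iff] at h1
  have h2 := h1 y (Finset.mem_univ _)
  rw [if_pos hw] at h2
  exact one_ne_zero h2

/-! ### One-shot distillation -/

/-- The weights of Bob's basis vectors. -/
noncomputable def weightB {A B : Type} [Fintype A] (Ψ : A × B → ℂ) (b : B) : ℝ := ∑ a, ‖Ψ (a, b)‖ ^ 2

theorem weightB_nonneg {A B : Type} [Fintype A] (Ψ : A × B → ℂ) (b : B) : 0 ≤ weightB Ψ b :=
  Finset.sum_nonneg fun _ _ => sq_nonneg _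

theorem sum_norm_sq_copies {A B : Type} [Fintype A] (Ψ : A × B → ℂ) {n : ℕ} (w : Fin n → B) :
    ∑ x, ‖copies n Ψ (x, w)‖ ^ 2 = ∏ i, weightB Ψ (w i) := by
  simp only [weightB, Fintype.prod_sum, copies, norm_prod, Finset.prod_pow]

/-- The normalised states of Alice that belong to the words of Bob's code. -/
noncomputable def codeStates {A B Z : Type} [Fintype A] (Ψ : A × B → ℂ) {m : ℕ}
    (c : Z → Fin m → B) : Matrix (Fin m → A) Z ℂ :=
  Matrix.of fun u y => ((√(∏ i, weightB Ψ (c y i)))⁻¹ : ℂ) * copies m Ψ (u, c y)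

theorem exists_distillation {A B : Type} [Fintype A] [DecidableEq A] [Fintype B] [DecidableEq B]
    {Ψ : A × B → ℂ} (hΨ : IsPureState Ψ) (m r : ℕ) {M : ℕ} (y₀ : Fin M) {c : Fin M → Fin m → B}
    (hinj : Function.Injective c) (hc : ∀ y y' b, letterCount (c y) b = letterCount (c y') b)
    (hpos : 0 < ∏ i, weightB Ψ (c y₀ i)) {V : Matrix ((Fin m → A) ⊕ Fin M) (Fin M) ℂ}
    (hV : Vᴴ * V = 1) {δ : ℝ} (hδ : 0 ≤ δ)
    (hov : M * (1 - δ ^ 2 / 2) ≤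
      (∑ u, ∑ y, star (V (Sum.inl u) y) * codeStates Ψ c u y).re) :
    ∃ (a : ℕ) (L : Matrix ((Fin (m + r) → A) × (Fin (m + r) → B))
        ((Fin (m + r) → A) × (Fin (m + r) → B)) ℂ → Matrix (Fin a × Fin M) (Fin a × Fin M) ℂ)
      (Λ : Fin a × Fin M → ℂ), IsLIOCC L ∧ IsMaximallyEntangled M Λ ∧
        traceDistance (L (density (copies (m + r) Ψ))) (density Λ) ≤
          ∑ w : Fin (m + r) → B with ¬ ∀ b, letterCount (c y₀) b ≤ letterCount w b,
            ∏ i, weightB Ψ (w i) + δ := by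
  have hM : 0 < M := y₀.pos
  have hM' : (0 : ℝ) < M := by exact_mod_cast hM
  let e := Fintype.equivFin ((Fin m → A) ⊕ Fin M)
  let V' : Matrix (Fin (Fintype.card ((Fin m → A) ⊕ Fin M))) (Fin M) ℂ := V.submatrix e.symm id
  have hV' : V'ᴴ * V' = 1 := by
    rw [← hV]
    ext y y'
    simp only [V', Matrix.mul_apply, Matrix.conjTranspose_apply, Matrix.submatrix_apply, id]
    exact e.symm.sum_comp fun s => star (V s y) * V s y'
  set Λ : Fin (Fintype.card ((Fin m → A) ⊕ Fin M)) × Fin M → ℂ :=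
    fun q => ((√M)⁻¹ : ℂ) * V' q.1 q.2 with hΛdef
  have hΛ : IsMaximallyEntangled M Λ := isMaximallyEntangled_of_isometry hM hV'
  set W := codeStates Ψ c with hW
  set P := ∏ i, weightB Ψ (c y₀ i) with hP
  have hPy : ∀ y, ∏ i, weightB Ψ (c y i) = P := by
    intro y
    obtain ⟨π, hπ⟩ := exists_perm_of_letterCount_eq (hc y y₀)
    rw [hπ, hP]
    exact Equiv.prod_comp π fun i => weightB Ψ (c y₀ i)
  have hWapply : ∀ u y, W u y = ((√P)⁻¹ : ℂ) * copies m Ψ (u, c y) := by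
    intro u y
    simp only [hW, codeStates, Matrix.of_apply, hPy]
  let F : (Fin m → A) ⊕ Fin M → Fin M → ℂ := fun s y => Sum.elim (fun u => W u y) (fun _ => 0) s
  set φ : Fin (Fintype.card ((Fin m → A) ⊕ Fin M)) × Fin M → ℂ :=
    fun q => ((√M)⁻¹ : ℂ) * F (e.symm q.1) q.2 with hφdef
  have hsqM : ((√M)⁻¹ : ℂ) * ((√M)⁻¹ : ℂ) = (M : ℂ)⁻¹ := by
    rw [← mul_inv, ← Complex.ofReal_mul, Real.mul_self_sqrt (Nat.cast_nonneg _),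
      Complex.ofReal_natCast]
  have hcol : ∀ y, ∑ u, ‖W u y‖ ^ 2 = 1 := by
    intro y
    simp only [hWapply, norm_mul, mul_pow, ← Finset.mul_sum]
    rw [sum_norm_sq_copies, hPy, norm_inv, Complex.norm_real,
      Real.norm_of_nonneg (Real.sqrt_nonneg _), inv_pow, Real.sq_sqrt hpos.le,
      inv_mul_cancel₀ hpos.ne']
  have hφ : vecNorm φ = 1 := by
    have h1 : vecNorm φ ^ 2 = 1 := by
      rw [vecNorm_sq, Fintype.sum_prod_type]
      simp only [hφdef, norm_mul, mul_pow]
      rw [e.symm.sum_comp fun s => ∑ y, ‖((√M)⁻¹ : ℂ)‖ ^ 2 * ‖F s y‖ ^ 2, Fintype.sum_sum_type]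
      simp only [F, Sum.elim_inl, Sum.elim_inr, norm_zero]
      rw [Finset.sum_comm]
      simp only [← Finset.mul_sum, hcol]
      rw [norm_inv, Complex.norm_real, Real.norm_of_nonneg (Real.sqrt_nonneg _), inv_pow,
        Real.sq_sqrt hM'.le]
      simp [hM'.ne']
    nlinarith [vecNorm_nonneg φ]
  have hover : star Λ ⬝ᵥ φ = (M : ℂ)⁻¹ * ∑ u, ∑ y, star (V (Sum.inl u) y) * W u y := by
    simp only [dotProduct, Fintype.sum_prod_type, Pi.star_apply, hΛdef, hφdef, V',
      Matrix.submatrix_apply, id]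
    rw [e.symm.sum_comp fun s => ∑ y, star (((√M)⁻¹ : ℂ) * V s y) * (((√M)⁻¹ : ℂ) * F s y),
      Fintype.sum_sum_type]
    simp only [F, Sum.elim_inl, Sum.elim_inr, mul_zero, Finset.sum_const_zero, add_zero,
      Finset.mul_sum]
    refine Finset.sum_congr rfl fun u _ => Finset.sum_congr rfl fun y _ => ?_
    rw [← hsqM, star_mul', Complex.star_def, map_inv₀, Complex.conj_ofReal]
    ring
  have hdist : vecNorm (φ - Λ) ≤ δ := by
    have h1 := vecNorm_sub_sq hφ hΛ.1.vecNorm_eq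
    have h2 : 1 - δ ^ 2 / 2 ≤ (star Λ ⬝ᵥ φ).re := by
      rw [hover, ← Complex.ofReal_natCast, ← Complex.ofReal_inv, Complex.re_ofReal_mul,
        ← div_eq_inv_mul, le_div_iff₀ hM', mul_comm]
      exact hov
    exact le_of_sq_le_sq (by linarith) hδ
  let ι := (Fin (m + r) ≃ Fin m ⊕ Fin r) × (Fin r → B)
  let f : ι → Fin M → Fin (m + r) → B := arrangedCode c
  let h : ι → (Fin (m + r) → A) → Fin (Fintype.card ((Fin m → A) ⊕ Fin M)) := fun q x =>
    e (Sum.inl fun i => x (q.1.symm (Sum.inl i)))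
  let k : ι → (Fin (m + r) → A) → Fin r → A := fun q x i => x (q.1.symm (Sum.inr i))
  have hhk : ∀ q x x', h q x = h q x' → k q x = k q x' → x = x' := by
    intro q x x' h1 h2
    ext i
    obtain ⟨s, rfl⟩ := q.1.symm.surjective i
    rcases s with j | j
    · exact congrFun (Sum.inl_injective (e.injective h1)) j
    · exact congrFun h2 j
  let C : ι → (Fin r → A) → ℂ := fun q j =>
    ((√(codeCount f (f q y₀)))⁻¹ : ℂ) * ((√P : ℂ) * (√M : ℂ) * copies r Ψ (j, q.2))
  have hP0 : (√P : ℂ) ≠ 0 := by exact_mod_cast (Real.sqrt_pos.mpr hpos).ne'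
  have hM0 : (√M : ℂ) ≠ 0 := by exact_mod_cast (Real.sqrt_pos.mpr hM').ne'
  have hout : ∀ q j s y, ((√(codeCount f (f q y)))⁻¹ : ℂ) *
      (∑ x, if s = h q x ∧ k q x = j then copies (m + r) Ψ (x, f q y) else 0) =
        C q j * φ (s, y) := by
    intro q j s y
    have hcnt : codeCount f (f q y) = codeCount f (f q y₀) := codeCount_arrangedCode_eq hc q y y₀
    rw [hcnt]
    simp only [C]
    rw [mul_assoc]
    congr 1
    obtain ⟨s, rfl⟩ := e.surjective s
    rcases s with u | y'
    · rw [Finset.sum_eq_single (Sum.elim u j ∘ q.1)]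
      · have hcond : e (Sum.inl u) = h q (Sum.elim u j ∘ q.1) ∧ k q (Sum.elim u j ∘ q.1) = j := by
          constructor
          · simp [h]
          · ext i; simp [k]
        rw [if_pos hcond]
        have h1 : copies (m + r) Ψ (Sum.elim u j ∘ q.1, f q y) =
            copies m Ψ (u, c y) * copies r Ψ (j, q.2) := by
          simp only [copies, f, arrangedCode, Function.comp_apply]
          rw [q.1.prod_comp fun t => Ψ (Sum.elim u j t, Sum.elim (c y) q.2 t),
            Fintype.prod_sum_type]
          simp
        rw [h1]
        simp only [hφdef, F, Equiv.symm_apply_apply, Sum.elim_inl, hWapply]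
        field_simp
      · intro x _ hx
        refine if_neg fun hcond => hx ?_
        apply hhk q
        · rw [← hcond.1]; simp [h]
        · rw [hcond.2]; ext i; simp [k]
      · simp
    · rw [Finset.sum_eq_zero]
      · simp [hφdef, F]
      · intro x _
        refine if_neg fun hcond => ?_
        have := e.injective hcond.1
        simp at this
  obtain ⟨L, hL, hLd⟩ := exists_protocol (copies_isPureState hΨ (m + r)) (f := f)
    (arrangedCode_injective hinj) y₀ (e (Sum.inr y₀)) hhk hφ hΛ.1.vecNorm_eq C hout
  refine ⟨_, L, Λ, hL, hΛ, hLd.trans (add_le_add ?_ hdist)⟩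
  simp only [sum_norm_sq_copies]
  refine Finset.sum_le_sum_of_subset_of_nonneg ?_ fun w _ _ =>
    Finset.prod_nonneg fun i _ => weightB_nonneg Ψ _
  intro w hw
  simp only [Finset.mem_filter, Finset.mem_univ, true_and] at hw ⊢
  exact fun hle => codeCount_arrangedCode_ne_zero c y₀ hle hw

/-! ### Typical words -/

theorem sum_weightB {A B : Type} [Fintype A] [Fintype B] {Ψ : A × B → ℂ} (hΨ : IsPureState Ψ) :
    ∑ b, weightB Ψ b = 1 := by
  rw [← show ∑ q, ‖Ψ q‖ ^ 2 = 1 from hΨ, Fintype.sum_prod_type_right]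
  rfl

theorem cast_letterCount {B : Type} [DecidableEq B] {n : ℕ} (w : Fin n → B) (b : B) :
    (letterCount w b : ℝ) = ∑ i, if w i = b then 1 else 0 := by
  rw [letterCount, Fintype.card_subtype]
  simp

/-- Letter counts concentrate around their means. -/
theorem sum_letterCount_deviation_le {B : Type} [Fintype B] [DecidableEq B] {p : B → ℝ}
    (hp0 : ∀ b, 0 ≤ p b) (hp : ∑ b, p b = 1) {n : ℕ} (hn : 0 < n) {δ : ℝ} (hδ : 0 < δ) (b : B)
    (s : Finset (Fin n → B)) (hs : ∀ w ∈ s, n * δ ≤ |letterCount w b - n * p b|) :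
    ∑ w ∈ s, ∏ i, p (w i) ≤ 1 / δ ^ 2 / n := by
  have hmean : ∑ y, p y * (if y = b then (1 : ℝ) else 0) = p b := by simp
  have h := sum_word_deviation_le (fun y => if y = b then (1 : ℝ) else 0) hp0 hp hn hδ s
    (by
      intro w hw
      have := hs w hw
      rw [cast_letterCount] at this
      rwa [hmean])
  rw [hmean] at h
  refine h.trans ?_
  gcongr
  calc ∑ y, p y * ((if y = b then (1 : ℝ) else 0) - p b) ^ 2 ≤ ∑ y, p y * 1 := by
        refine Finset.sum_le_sum fun y _ => mul_le_mul_of_nonneg_left ?_ (hp0 y)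
        have h1 : p b ≤ 1 := by
          rw [← hp]; exact Finset.single_le_sum (fun i _ => hp0 i) (Finset.mem_univ b)
        have h0 := hp0 b
        split_ifs <;> nlinarith
    _ = 1 := by simp [hp]

theorem sum_exists_le {B W : Type} [Fintype B] [DecidableEq W] {p : W → ℝ} (hp : ∀ w, 0 ≤ p w)
    (s : B → Finset W) {C : ℝ} (hs : ∀ b, ∑ w ∈ s b, p w ≤ C) :
    ∑ w ∈ Finset.univ.biUnion s, p w ≤ Fintype.card B * C := by
  have h1 : ∑ w ∈ Finset.univ.biUnion s, p w ≤ ∑ b, ∑ w ∈ s b, p w := by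
    rw [← Finset.sum_sigma Finset.univ s fun q => p q.2]
    have hsub : Finset.univ.biUnion s =
        (Finset.univ.sigma s).image (fun q : Σ _ : B, W => q.2) := by
      ext w; simp
    rw [hsub]
    exact Finset.sum_image_le_of_nonneg (fun _ _ => hp _)
  refine h1.trans ((Finset.sum_le_sum fun b _ => hs b).trans ?_)
  simp

/-- Some class of a partition into few classes carries a corresponding share of the weight. -/
theorem exists_fiber_weight_le {W T : Type} [Fintype T] [DecidableEq T] [Nonempty T]
    (s : Finset W) (t : W → T) {p : W → ℝ} {x : ℝ} (hx : x ≤ ∑ w ∈ s, p w) :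
    ∃ a, x / Fintype.card T ≤ ∑ w ∈ s with t w = a, p w := by
  by_contra! h
  have h1 : ∑ a, ∑ w ∈ s with t w = a, p w < ∑ _a : T, x / Fintype.card T :=
    Finset.sum_lt_sum_of_nonempty Finset.univ_nonempty fun a _ => h a
  rw [Finset.sum_fiberwise] at h1
  have hc : (Fintype.card T : ℝ) ≠ 0 := by exact_mod_cast Fintype.card_ne_zero
  simp only [Finset.sum_const, Finset.card_univ, nsmul_eq_mul] at h1
  rw [mul_div_cancel₀ _ hc] at h1
  linarith

/-! ### Truncated code states -/

/-- The component of Alice's state for the word `x` in the span of the Schmidt vectors indexed by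
`S`, in Schmidt coordinates. -/
noncomputable def truncated {K X : Type} [DecidableEq K] (S : Finset K) (Y : Matrix K X ℂ)
    (p : X → ℝ) (x : X) : K → ℂ :=
  fun k => if k ∈ S then ((√(p x))⁻¹ : ℂ) * Y k x else 0

theorem sum_norm_sq_vecMul {K X : Type} [Fintype K] [DecidableEq K] [Fintype X] {Y : Matrix K X ℂ}
    {lam : K → ℝ} (hY : Y * Yᴴ = Matrix.diagonal fun i => (lam i : ℂ)) (u : K → ℂ) :
    ∑ x, ‖∑ k, star (u k) * Y k x‖ ^ 2 = ∑ k, lam k * ‖u k‖ ^ 2 := by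
  let R : Matrix Unit K ℂ := Matrix.of fun _ k => star (u k)
  have h1 := mul_conjTranspose_apply_self (R * Y) ()
  have h2 : R * Y * (R * Y)ᴴ = R * (Y * Yᴴ) * Rᴴ := by
    rw [Matrix.conjTranspose_mul]; simp only [Matrix.mul_assoc]
  apply Complex.ofReal_injective
  calc ((∑ x, ‖∑ k, star (u k) * Y k x‖ ^ 2 : ℝ) : ℂ) = (R * Y * (R * Y)ᴴ) () () := by
        rw [h1]
        simp [R, Matrix.mul_apply]
    _ = _ := by
        rw [h2, hY, Matrix.mul_apply]
        push_cast
        refine Finset.sum_congr rfl fun k _ => ?_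
        rw [Matrix.mul_diagonal, Matrix.conjTranspose_apply]
        simp only [R, Matrix.of_apply, star_star]
        rw [← Complex.conj_mul', Complex.star_def]
        ring

theorem truncated_frame_le {K X : Type} [Fintype K] [DecidableEq K] [Fintype X] {Y : Matrix K X ℂ}
    {lam : K → ℝ} (hY : Y * Yᴴ = Matrix.diagonal fun i => (lam i : ℂ)) {S : Finset K}
    {p : X → ℝ} {ℓ P : ℝ} (hP : 0 < P) (hℓ : 0 ≤ ℓ) (hS : ∀ k ∈ S, lam k ≤ ℓ) {s : Finset X}
    (hs : ∀ x ∈ s, p x = P) (u : K → ℂ) :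
    ∑ x ∈ s, ‖star u ⬝ᵥ truncated S Y p x‖ ^ 2 ≤ ℓ / P * vecNorm u ^ 2 := by
  let u' : K → ℂ := fun k => if k ∈ S then u k else 0
  have h1 : ∀ x ∈ s, ‖star u ⬝ᵥ truncated S Y p x‖ ^ 2 =
      P⁻¹ * ‖∑ k, star (u' k) * Y k x‖ ^ 2 := by
    intro x hx
    have : star u ⬝ᵥ truncated S Y p x = ((√P)⁻¹ : ℂ) * ∑ k, star (u' k) * Y k x := by
      rw [dotProduct, Finset.mul_sum]
      refine Finset.sum_congr rfl fun k _ => ?_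
      simp only [truncated, u', hs x hx, Pi.star_apply]
      split_ifs
      · ring
      · simp
    rw [this, norm_mul, mul_pow, norm_inv, Complex.norm_real,
      Real.norm_of_nonneg (Real.sqrt_nonneg _), inv_pow, Real.sq_sqrt hP.le]
  rw [Finset.sum_congr rfl h1, ← Finset.mul_sum]
  have h2 : ∑ x ∈ s, ‖∑ k, star (u' k) * Y k x‖ ^ 2 ≤ ℓ * vecNorm u ^ 2 := by
    refine (Finset.sum_le_univ_sum_of_nonneg fun x => sq_nonneg _).trans ?_
    rw [sum_norm_sq_vecMul hY, vecNorm_sq, Finset.mul_sum]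
    refine Finset.sum_le_sum fun k _ => ?_
    simp only [u']
    split_ifs with hk
    · exact mul_le_mul_of_nonneg_right (hS k hk) (sq_nonneg _)
    · rw [norm_zero]
      have := mul_nonneg hℓ (sq_nonneg ‖u k‖)
      simpa using this
  calc _ ≤ P⁻¹ * (ℓ * vecNorm u ^ 2) := mul_le_mul_of_nonneg_left h2 (inv_nonneg.mpr hP.le)
    _ = _ := by ring

theorem vecNorm_truncated_sq {K X : Type} [Fintype K] [DecidableEq K] (S : Finset K)
    (Y : Matrix K X ℂ) (p : X → ℝ) (x : X) (hp : 0 ≤ p x) :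
    vecNorm (truncated S Y p x) ^ 2 = (p x)⁻¹ * ∑ k ∈ S, ‖Y k x‖ ^ 2 := by
  rw [vecNorm_sq, Finset.mul_sum, ← Finset.sum_subset (Finset.subset_univ S)]
  · refine Finset.sum_congr rfl fun k hk => ?_
    rw [truncated, if_pos hk, norm_mul, mul_pow, norm_inv, Complex.norm_real,
      Real.norm_of_nonneg (Real.sqrt_nonneg _), inv_pow, Real.sq_sqrt hp]
  · intro k _ hk
    simp [truncated, hk]

theorem vecNorm_truncated_le_one {K X : Type} [Fintype K] [DecidableEq K] (S : Finset K)
    {Y : Matrix K X ℂ} {p : X → ℝ} (hp : ∀ x, ∑ k, ‖Y k x‖ ^ 2 = p x) (x : X) :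
    vecNorm (truncated S Y p x) ≤ 1 := by
  have h0 : 0 ≤ p x := by rw [← hp]; exact Finset.sum_nonneg fun _ _ => sq_nonneg _
  have h1 : vecNorm (truncated S Y p x) ^ 2 ≤ 1 := by
    rw [vecNorm_truncated_sq S Y p x h0]
    have h2 : ∑ k ∈ S, ‖Y k x‖ ^ 2 ≤ p x := by
      rw [← hp]; exact Finset.sum_le_univ_sum_of_nonneg fun _ => sq_nonneg _
    exact inv_mul_le_one_of_le₀ h2 h0
  nlinarith [vecNorm_nonneg (truncated S Y p x)]

/-- Markov's inequality: most words have most of their weight inside the truncation. -/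
theorem sum_truncated_small_le {K X : Type} [Fintype K] [DecidableEq K] [Fintype X]
    (S : Finset K) {Y : Matrix K X ℂ} {lam : K → ℝ}
    (hY : Y * Yᴴ = Matrix.diagonal fun i => (lam i : ℂ)) {p : X → ℝ}
    (hp : ∀ x, ∑ k, ‖Y k x‖ ^ 2 = p x) {η : ℝ} (hη : 0 < η) (s : Finset X)
    (hs : ∀ x ∈ s, vecNorm (truncated S Y p x) ^ 2 ≤ 1 - η) :
    ∑ x ∈ s, p x ≤ (∑ k ∈ Sᶜ, lam k) / η := by
  rw [le_div_iff₀ hη, Finset.sum_mul]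
  have h0 : ∀ x, 0 ≤ p x := fun x => by
    rw [← hp]; exact Finset.sum_nonneg fun _ _ => sq_nonneg _
  calc ∑ x ∈ s, p x * η ≤ ∑ x ∈ s, ∑ k ∈ Sᶜ, ‖Y k x‖ ^ 2 := by
        refine Finset.sum_le_sum fun x hx => ?_
        have h1 := hs x hx
        have h2 := hp x
        rw [vecNorm_truncated_sq S Y p x (h0 x)] at h1
        rw [← Finset.sum_add_sum_compl S] at h2
        rcases (h0 x).eq_or_lt with h | h
        · rw [← h, zero_mul]
          exact Finset.sum_nonneg fun _ _ => sq_nonneg _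
        · rw [inv_mul_le_iff₀ h] at h1
          linarith
    _ ≤ ∑ x, ∑ k ∈ Sᶜ, ‖Y k x‖ ^ 2 :=
        Finset.sum_le_univ_sum_of_nonneg fun x => Finset.sum_nonneg fun _ _ => sq_nonneg _
    _ = ∑ k ∈ Sᶜ, lam k := by
        rw [Finset.sum_comm]
        exact Finset.sum_congr rfl fun k _ => sum_norm_sq_row hY k

/-- Words of atypically large probability have small total weight. -/
theorem sum_large_prob_le {Y : Type} [Fintype Y] [DecidableEq Y] {p : Y → ℝ} (hp0 : ∀ y, 0 ≤ p y)
    (hp : ∑ y, p y = 1) {n : ℕ} (hn : 0 < n) {δ : ℝ} (hδ : 0 < δ) (s : Finset (Fin n → Y))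
    (hs : ∀ w ∈ s, (2 : ℝ) ^ (-(n * ((∑ y, p y * -Real.logb 2 (p y)) - δ))) < ∏ i, p (w i)) :
    ∑ w ∈ s, ∏ i, p (w i) ≤ (∑ y, p y * (-Real.logb 2 (p y) -
      ∑ y, p y * -Real.logb 2 (p y)) ^ 2) / δ ^ 2 / n := by
  refine sum_word_deviation_le (fun y => -Real.logb 2 (p y)) hp0 hp hn hδ s fun w hw => ?_
  have h1 := hs w hw
  set E := ∑ y, p y * -Real.logb 2 (p y)
  have hpos : 0 < ∏ i, p (w i) := lt_trans (Real.rpow_pos_of_pos (by norm_num) _) h1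
  have h2 := (Real.lt_logb_iff_rpow_lt (by norm_num) hpos).mpr h1
  rw [Real.logb_prod _ _ fun i _ => (Finset.prod_ne_zero_iff.mp hpos.ne') i (Finset.mem_univ i)]
    at h2
  rw [Finset.sum_neg_distrib, le_abs]
  right
  linarith

/-! ### Existence of good codes -/

theorem sum_norm_sq_col_unitary {A B : Type} [Fintype A] [DecidableEq A] {U : Matrix A A ℂ}
    (hU : U * Uᴴ = 1) (X : Matrix A B ℂ) (b : B) :
    ∑ a, ‖(Uᴴ * X) a b‖ ^ 2 = ∑ a, ‖X a b‖ ^ 2 := by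
  have key : ∀ Y : Matrix A B ℂ, (Yᴴ * Y) b b = ((∑ a, ‖Y a b‖ ^ 2 : ℝ) : ℂ) := by
    intro Y
    have h := mul_conjTranspose_apply_self Yᴴ b
    simpa using h
  apply Complex.ofReal_injective
  rw [← key, ← key, Matrix.conjTranspose_mul, Matrix.conjTranspose_conjTranspose, Matrix.mul_assoc,
    ← Matrix.mul_assoc U, hU, Matrix.one_mul]

theorem letterCount_le {B : Type} [DecidableEq B] {m : ℕ} (w : Fin m → B) (b : B) :
    letterCount w b ≤ m := by
  have := Fintype.card_subtype_le fun i => w i = b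
  rwa [Fintype.card_fin] at this

theorem prod_eq_of_letterCount_eq {I B : Type} [Fintype I] [DecidableEq B] {c w : I → B}
    (h : ∀ b, letterCount c b = letterCount w b) (p : B → ℝ) :
    ∏ i, p (c i) = ∏ i, p (w i) := by
  obtain ⟨π, rfl⟩ := exists_perm_of_letterCount_eq h
  exact Equiv.prod_comp π fun i => p (w i)

/-- The set of typical words of Bob has weight at least one half. -/
theorem half_le_sum_typical {A B : Type} [Fintype A] [DecidableEq A] [Fintype B] [DecidableEq B]
    {Ψ : A × B → ℂ} (hΨ : IsPureState Ψ) {Y : Matrix A B ℂ} {lam : A → ℝ}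
    (hY : Y * Yᴴ = Matrix.diagonal fun i => (lam i : ℂ))
    (hcol : ∀ b, ∑ a, ‖Y a b‖ ^ 2 = weightB Ψ b)
    (hlam0 : ∀ i, 0 ≤ lam i) (hlam1 : ∑ i, lam i = 1) {m : ℕ} (hm : 0 < m)
    {δ δ' η : ℝ} (hδ : 0 < δ) (hδ' : 0 < δ') (hη : 0 < η)
    (hsmall : (∑ i, lam i * (-Real.logb 2 (lam i) - ∑ i, lam i * -Real.logb 2 (lam i)) ^ 2) /
      δ ^ 2 / m / η + Fintype.card B * (1 / δ' ^ 2 / m) ≤ 1 / 2)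
    (S : Finset (Fin m → A))
    (hS : ∀ k ∉ S, (2 : ℝ) ^ (-(m * ((∑ i, lam i * -Real.logb 2 (lam i)) - δ))) <
      ∏ i, lam (k i)) :
    1 / 2 ≤ ∑ x : Fin m → B with 0 < ∏ i, weightB Ψ (x i) ∧
      (∀ b, (letterCount x b : ℝ) ≤ m * (weightB Ψ b + δ')) ∧
      1 - η ≤ vecNorm (truncated S (tensorPower m Y) (fun x => ∏ i, weightB Ψ (x i)) x) ^ 2,
        ∏ i, weightB Ψ (x i) := by
  set p : (Fin m → B) → ℝ := fun x => ∏ i, weightB Ψ (x i) with hp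
  have hp0 : ∀ x, 0 ≤ p x := fun x => Finset.prod_nonneg fun i _ => weightB_nonneg Ψ _
  have hp1 : ∑ x, p x = 1 := by rw [sum_prod_word, sum_weightB hΨ, one_pow]
  have hYn := tensorPower_schmidt hY m
  have hcoln : ∀ x, ∑ k, ‖tensorPower m Y k x‖ ^ 2 = p x := by
    intro x
    simp only [tensorPower, Matrix.of_apply, norm_prod, ← Finset.prod_pow, hp, ← hcol,
      Fintype.prod_sum]
  set v := truncated S (tensorPower m Y) p
  set bad : B → Finset (Fin m → B) := fun b =>
    Finset.univ.filter fun x => m * (weightB Ψ b + δ') < letterCount x b with hbad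
  set small := Finset.univ.filter fun x => vecNorm (v x) ^ 2 < 1 - η with hsm
  have h1 : ∑ x ∈ Finset.univ.biUnion bad, p x ≤ Fintype.card B * (1 / δ' ^ 2 / m) := by
    refine sum_exists_le hp0 bad fun b => ?_
    refine sum_letterCount_deviation_le (weightB_nonneg Ψ) (sum_weightB hΨ) hm hδ' b _ ?_
    intro w hw
    have := (Finset.mem_filter.mp hw).2
    rw [le_abs]
    left
    linarith
  have h2 : ∑ x ∈ small, p x ≤ (∑ i, lam i * (-Real.logb 2 (lam i) -
      ∑ i, lam i * -Real.logb 2 (lam i)) ^ 2) / δ ^ 2 / m / η := by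
    refine (sum_truncated_small_le S hYn hcoln hη small
      fun x hx => (Finset.mem_filter.mp hx).2.le).trans ?_
    gcongr
    exact sum_large_prob_le hlam0 hlam1 hm hδ Sᶜ fun k hk => hS k (Finset.mem_compl.mp hk)
  have h3 : ∑ x, p x ≤ (∑ x with 0 < p x ∧ (∀ b, (letterCount x b : ℝ) ≤
      m * (weightB Ψ b + δ')) ∧ 1 - η ≤ vecNorm (v x) ^ 2, p x) +
      ∑ x ∈ Finset.univ.biUnion bad, p x + ∑ x ∈ small, p x := by
    rw [Finset.sum_filter, ← Fintype.sum_ite_mem (Finset.univ.biUnion bad), ← Fintype.sum_ite_mem small,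
      ← Finset.sum_add_distrib, ← Finset.sum_add_distrib]
    refine Finset.sum_le_sum fun x _ => ?_
    have e1 : 0 ≤ if x ∈ Finset.univ.biUnion bad then p x else 0 := by
      split_ifs; exacts [hp0 x, le_rfl]
    have e2 : 0 ≤ if x ∈ small then p x else 0 := by
      split_ifs; exacts [hp0 x, le_rfl]
    have e3 : 0 ≤ if 0 < p x ∧ (∀ b, (letterCount x b : ℝ) ≤ m * (weightB Ψ b + δ')) ∧
        1 - η ≤ vecNorm (v x) ^ 2 then p x else 0 := by
      split_ifs; exacts [hp0 x, le_rfl]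
    by_cases c1 : x ∈ Finset.univ.biUnion bad
    · rw [if_pos c1] at e1 ⊢; linarith
    by_cases c2 : x ∈ small
    · rw [if_pos c2] at e2 ⊢; linarith
    rcases (hp0 x).eq_or_lt with h | h
    · linarith
    · have c3 : 0 < p x ∧ (∀ b, (letterCount x b : ℝ) ≤ m * (weightB Ψ b + δ')) ∧
          1 - η ≤ vecNorm (v x) ^ 2 := by
        refine ⟨h, fun b => ?_, ?_⟩
        · by_contra! hb
          exact c1 (Finset.mem_biUnion.mpr ⟨b, Finset.mem_univ b, by simpa [hbad] using hb⟩)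
        · by_contra! hb
          exact c2 (by simpa [hsm] using hb)
      rw [if_pos c3]; linarith
  linarith

theorem codeStates_gram {A B : Type} [Fintype A] [DecidableEq A] [Fintype B]
    (Ψ : A × B → ℂ) (U : Matrix A A ℂ) {m M : ℕ} (S : Finset (Fin m → A))
    (c : Fin M → Fin m → B) (y y' : Fin M) :
    ((codeStates Ψ c)ᴴ * spanProj (tensorPower m U) S * codeStates Ψ c) y y' =
      star (truncated S (tensorPower m (Uᴴ * coeffMatrix Ψ)) (fun x => ∏ i, weightB Ψ (x i)) (c y))
        ⬝ᵥ truncated S (tensorPower m (Uᴴ * coeffMatrix Ψ)) (fun x => ∏ i, weightB Ψ (x i))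
          (c y') := by
  set W := codeStates Ψ c with hW
  set Un := tensorPower m U with hUn
  have hZ : ∀ k y, (Unᴴ * W) k y = ((√(∏ i, weightB Ψ (c y i)))⁻¹ : ℂ) *
      tensorPower m (Uᴴ * coeffMatrix Ψ) k (c y) := by
    intro k y
    rw [tensorPower_mul, tensorPower_conjTranspose, Matrix.mul_apply, Matrix.mul_apply,
      Finset.mul_sum]
    refine Finset.sum_congr rfl fun u _ => ?_
    rw [← coeffMatrix_copies]
    simp only [hW, codeStates, coeffMatrix, Matrix.of_apply]
    ring
  have h1 : Wᴴ * spanProj Un S * W = (Unᴴ * W)ᴴ *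
      Matrix.diagonal (fun i => if i ∈ S then (1 : ℂ) else 0) * (Unᴴ * W) := by
    rw [spanProj, Matrix.conjTranspose_mul, Matrix.conjTranspose_conjTranspose]
    simp only [Matrix.mul_assoc]
  rw [h1, Matrix.mul_apply, dotProduct]
  refine Finset.sum_congr rfl fun k _ => ?_
  rw [Matrix.mul_diagonal, Matrix.conjTranspose_apply, hZ, hZ]
  simp only [truncated, Pi.star_apply]
  split_ifs <;> simp

theorem exists_code {A B : Type} [Fintype A] [DecidableEq A] [Fintype B] [DecidableEq B]
    {Ψ : A × B → ℂ} (hΨ : IsPureState Ψ) {U : Matrix A A ℂ} {lam : A → ℝ} (hU1 : U * Uᴴ = 1)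
    (hU2 : Uᴴ * U = 1)
    (hY : (Uᴴ * coeffMatrix Ψ) * (Uᴴ * coeffMatrix Ψ)ᴴ = Matrix.diagonal fun i => (lam i : ℂ))
    (hlam0 : ∀ i, 0 ≤ lam i) (hlam1 : ∑ i, lam i = 1) {m : ℕ} (hm : 0 < m)
    {δ δ' η : ℝ} (hδ : 0 < δ) (hδ' : 0 < δ') (hη : 0 < η) (hη4 : η ≤ 1 / 4)
    (hsmall : (∑ i, lam i * (-Real.logb 2 (lam i) - ∑ i, lam i * -Real.logb 2 (lam i)) ^ 2) /
      δ ^ 2 / m / η + Fintype.card B * (1 / δ' ^ 2 / m) ≤ 1 / 2) :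
    ∃ (M : ℕ) (y₀ : Fin M) (c : Fin M → Fin m → B) (V : Matrix ((Fin m → A) ⊕ Fin M) (Fin M) ℂ),
      Function.Injective c ∧ (∀ y y' b, letterCount (c y) b = letterCount (c y') b) ∧
      0 < ∏ i, weightB Ψ (c y₀ i) ∧
      (∀ b, (letterCount (c y₀) b : ℝ) ≤ m * (weightB Ψ b + δ')) ∧ Vᴴ * V = 1 ∧
      M * (1 - (2 * √η) ^ 2 / 2) ≤
        (∑ u, ∑ y, star (V (Sum.inl u) y) * codeStates Ψ c u y).re ∧
      η * (1 / 2 / ((m + 1 : ℕ) ^ Fintype.card B : ℕ)) *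
        2 ^ (m * ((∑ i, lam i * -Real.logb 2 (lam i)) - δ)) ≤ M := by
  set E := ∑ i, lam i * -Real.logb 2 (lam i)
  set ℓ : ℝ := 2 ^ (-(m * (E - δ))) with hℓ
  have hℓ0 : 0 < ℓ := Real.rpow_pos_of_pos (by norm_num) _
  set S : Finset (Fin m → A) := Finset.univ.filter fun k => ∏ i, lam (k i) ≤ ℓ with hS
  have hcol : ∀ b, ∑ a, ‖(Uᴴ * coeffMatrix Ψ) a b‖ ^ 2 = weightB Ψ b :=
    fun b => sum_norm_sq_col_unitary hU1 _ b
  set Yn := tensorPower m (Uᴴ * coeffMatrix Ψ) with hYndef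
  have hYn := tensorPower_schmidt hY m
  set p : (Fin m → B) → ℝ := fun x => ∏ i, weightB Ψ (x i) with hp
  have hcoln : ∀ x, ∑ k, ‖Yn k x‖ ^ 2 = p x := by
    intro x
    simp only [hYndef, tensorPower, Matrix.of_apply, norm_prod, ← Finset.prod_pow, hp, ← hcol,
      Fintype.prod_sum]
  set v := truncated S Yn p with hv
  have htyp := half_le_sum_typical hΨ hY hcol hlam0 hlam1 hm hδ hδ' hη hsmall S
    (fun k hk => not_le.mp fun h => hk (Finset.mem_filter.mpr ⟨Finset.mem_univ k, h⟩))
  set good := Finset.univ.filter fun x : Fin m → B => 0 < ∏ i, weightB Ψ (x i) ∧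
      (∀ b, (letterCount x b : ℝ) ≤ m * (weightB Ψ b + δ')) ∧
      1 - η ≤ vecNorm (truncated S (tensorPower m (Uᴴ * coeffMatrix Ψ))
        (fun x => ∏ i, weightB Ψ (x i)) x) ^ 2 with hgood
  let t : (Fin m → B) → B → Fin (m + 1) := fun x b =>
    ⟨letterCount x b, Nat.lt_succ_of_le (letterCount_le x b)⟩
  obtain ⟨a, ha⟩ := exists_fiber_weight_le good t htyp
  rw [Fintype.card_fun, Fintype.card_fin] at ha
  set ω : ℝ := 1 / 2 / ((m + 1 : ℕ) ^ Fintype.card B : ℕ) with hω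
  have hω0 : 0 < ω := by positivity
  set s := good.filter fun x => t x = a with hs
  have hsne : s.Nonempty := by
    by_contra h
    rw [Finset.not_nonempty_iff_eq_empty] at h
    rw [h, Finset.sum_empty] at ha
    linarith
  have hsgood : ∀ x ∈ s, 0 < p x ∧ (∀ b, (letterCount x b : ℝ) ≤ m * (weightB Ψ b + δ')) ∧
      1 - η ≤ vecNorm (v x) ^ 2 := fun x hx =>
    (Finset.mem_filter.mp (Finset.mem_filter.mp hx).1).2
  have hscount : ∀ x ∈ s, ∀ x' ∈ s, ∀ b, letterCount x b = letterCount x' b := by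
    intro x hx x' hx' b
    have h1 := congrFun ((Finset.mem_filter.mp hx).2.trans (Finset.mem_filter.mp hx').2.symm) b
    simpa [t] using h1
  obtain ⟨x₀, hx₀⟩ := hsne
  set P := p x₀ with hP
  have hP0 : 0 < P := (hsgood x₀ hx₀).1
  have hpP : ∀ x ∈ s, p x = P := fun x hx =>
    prod_eq_of_letterCount_eq (hscount x hx x₀ hx₀) (weightB Ψ)
  have hcard : ω ≤ s.card * P := by
    refine ha.trans (le_of_eq ?_)
    rw [← nsmul_eq_mul]
    exact Finset.sum_eq_card_nsmul hpP
  set κ := ℓ / ω with hκ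
  have hκ0 : 0 < κ := by positivity
  have hframe : ∀ u : (Fin m → A) → ℂ,
      ∑ x ∈ s, ‖star u ⬝ᵥ v x‖ ^ 2 ≤ κ * s.card * vecNorm u ^ 2 := by
    intro u
    refine (truncated_frame_le hYn hP0 hℓ0.le (fun k hk => (Finset.mem_filter.mp hk).2) hpP
      u).trans (mul_le_mul_of_nonneg_right ?_ (sq_nonneg _))
    rw [hκ, div_mul_eq_mul_div, div_le_div_iff₀ hP0 hω0, mul_assoc]
    exact mul_le_mul_of_nonneg_left hcard hℓ0.le
  have hv1 : ∀ x, vecNorm (v x) ≤ 1 := vecNorm_truncated_le_one S hcoln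
  set M := ⌊η / κ⌋₊ + 1 with hM
  obtain ⟨c, hc1, hc2⟩ := exists_greedy s ⟨x₀, hx₀⟩ v hκ0.le (γ := η) (fun x _ => hv1 x) hframe M
    (by
      rw [hM]
      push_cast
      rw [add_sub_cancel_right, ← le_div_iff₀ hκ0]
      exact Nat.floor_le (by positivity))
  have hnear : ∀ y, 1 - η ≤ vecNorm (v (c y)) ^ 2 := fun y => (hsgood _ (hc1 y)).2.2
  have hUn : (tensorPower m U)ᴴ * tensorPower m U = 1 := by
    rw [← tensorPower_conjTranspose, ← tensorPower_mul, hU2, tensorPower_one]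
  obtain ⟨V, hV, hVov⟩ := exists_isometry_near (W := codeStates Ψ c)
    (spanProj_conjTranspose (tensorPower m U) S) (spanProj_mul_self hUn S) rfl
  set G := (codeStates Ψ c)ᴴ * spanProj (tensorPower m U) S * codeStates Ψ c with hG
  have hGram : ∀ y y', G y y' = star (v (c y)) ⬝ᵥ v (c y') := codeStates_gram Ψ U S c
  have hfrob : ∑ i, ∑ j, ‖(G - 1) i j‖ ^ 2 ≤ M * (η ^ 2 + 2 * η) := by
    have := gram_sub_one_le (v := fun y => v (c y)) (fun y => hv1 _) hnear hc2
    simpa only [Matrix.sub_apply, hGram] using this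
  have htrace : -(M * η) ≤ (G - 1).trace.re := by
    rw [Matrix.trace, Complex.re_sum]
    have : ∑ _y : Fin M, -η ≤ ∑ y, ((G - 1).diag y).re := by
      refine Finset.sum_le_sum fun y _ => ?_
      rw [Matrix.diag_apply, Matrix.sub_apply, hGram, star_dotProduct_self, Matrix.one_apply_eq,
        Complex.sub_re, Complex.ofReal_re, Complex.one_re]
      linarith [hnear y]
    simpa using this
  let y₀ : Fin M := ⟨0, Nat.succ_pos _⟩
  refine ⟨M, y₀, c, V, injective_of_greedy (by linarith) hnear hc2 (by nlinarith),
    fun y y' => hscount _ (hc1 y) _ (hc1 y'), (hsgood _ (hc1 y₀)).1, (hsgood _ (hc1 y₀)).2.1, hV,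
    ?_, ?_⟩
  · refine le_trans ?_ hVov
    rw [mul_pow, Real.sq_sqrt hη.le, Fintype.card_fin]
    have hM0 : (0 : ℝ) ≤ M := Nat.cast_nonneg _
    have h1 : (M : ℝ) * η ^ 2 ≤ M * η := mul_le_mul_of_nonneg_left (by nlinarith) hM0
    linarith
  · have h1 : η / κ < M := by rw [hM]; exact_mod_cast Nat.lt_floor_add_one (η / κ)
    refine le_trans (le_of_eq ?_) h1.le
    rw [hκ, hℓ, Real.rpow_neg (by norm_num), div_div_eq_mul_div, div_inv_eq_mul]

/-! ### Achievability -/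

open Filter Topology in
theorem tendsto_logb_succ_div (a b : ℝ) :
    Tendsto (fun m : ℕ => (a * Real.logb 2 (m + 1) + b) / (m : ℝ)) atTop (𝓝 0) := by
  have h1 : Tendsto (fun x : ℝ => Real.log x ^ 1 / (1 * x + -1)) atTop (𝓝 0) :=
    Real.tendsto_pow_log_div_mul_add_atTop 1 (-1) 1 one_ne_zero
  have h2 : Tendsto (fun m : ℕ => (m : ℝ) + 1) atTop atTop :=
    tendsto_atTop_add_const_right _ _ tendsto_natCast_atTop_atTop
  have h3 := ((h1.comp h2).const_mul (a / Real.log 2)).add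
    (tendsto_const_div_atTop_nhds_zero_nat b)
  rw [mul_zero, add_zero] at h3
  refine h3.congr fun m => ?_
  simp only [Function.comp_apply, Real.logb, pow_one, one_mul, add_neg_cancel_right]
  ring

theorem exists_pos_le_weightB {A B : Type} [Fintype A] [Fintype B] (Ψ : A × B → ℂ) :
    ∃ r : ℝ, 0 < r ∧ ∀ b, weightB Ψ b ≠ 0 → r ≤ weightB Ψ b := by
  classical
  by_cases h : (Finset.univ.filter fun b => weightB Ψ b ≠ 0).Nonempty
  · obtain ⟨b₀, hb₀, hmin⟩ := Finset.exists_min_image _ (weightB Ψ) h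
    refine ⟨weightB Ψ b₀, lt_of_le_of_ne (weightB_nonneg Ψ b₀)
      (Ne.symm (Finset.mem_filter.mp hb₀).2), fun b hb => hmin b ?_⟩
    simpa using hb
  · refine ⟨1, one_pos, fun b hb => absurd ⟨b, ?_⟩ h⟩
    simpa using hb

/-- A random word of length `m + k` contains the letters of a typical word of length `m`, up to a
small probability. -/
theorem sum_not_letterCount_le {A B : Type} [Fintype A] [Fintype B] [DecidableEq B]
    {Ψ : A × B → ℂ} (hΨ : IsPureState Ψ) {m k : ℕ} (hk : 0 < k) {r δ' : ℝ} (hδ' : 0 < δ')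
    (hr : ∀ b, weightB Ψ b ≠ 0 → r ≤ weightB Ψ b) (hmk : ((m + k : ℕ) + m : ℝ) * δ' ≤ k * r)
    {c : Fin m → B} (hpos : 0 < ∏ i, weightB Ψ (c i))
    (hc : ∀ b, (letterCount c b : ℝ) ≤ m * (weightB Ψ b + δ')) :
    ∑ w : Fin (m + k) → B with ¬ ∀ b, letterCount c b ≤ letterCount w b, ∏ i, weightB Ψ (w i) ≤
      Fintype.card B * (1 / δ' ^ 2 / (m + k : ℕ)) := by
  have hp0 : ∀ w : Fin (m + k) → B, 0 ≤ ∏ i, weightB Ψ (w i) := fun w =>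
    Finset.prod_nonneg fun i _ => weightB_nonneg Ψ _
  set bad : B → Finset (Fin (m + k) → B) := fun b => Finset.univ.filter fun w =>
    (m + k : ℕ) * δ' ≤ |(letterCount w b : ℝ) - (m + k : ℕ) * weightB Ψ b| with hbad
  refine le_trans (Finset.sum_le_sum_of_subset_of_nonneg ?_ fun w _ _ => hp0 w)
    (sum_exists_le hp0 bad fun b => ?_)
  · intro w hw
    simp only [Finset.mem_filter, Finset.mem_univ, true_and, not_forall, not_le] at hw
    obtain ⟨b, hb⟩ := hw
    refine Finset.mem_biUnion.mpr ⟨b, Finset.mem_univ b, ?_⟩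
    have hb0 : weightB Ψ b ≠ 0 := by
      have hcb : 0 < letterCount c b := lt_of_le_of_lt (Nat.zero_le _) hb
      rw [letterCount, Fintype.card_pos_iff] at hcb
      obtain ⟨i, hi⟩ := hcb
      rw [← hi]
      exact (Finset.prod_ne_zero_iff.mp hpos.ne') i (Finset.mem_univ i)
    have h1 := hr b hb0
    have h2 : (letterCount w b : ℝ) ≤ letterCount c b := by exact_mod_cast hb.le
    have h3 := hc b
    have h4 : (k : ℝ) * r ≤ k * weightB Ψ b := mul_le_mul_of_nonneg_left h1 (Nat.cast_nonneg _)
    simp only [hbad, Finset.mem_filter, Finset.mem_univ, true_and]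
    rw [le_abs]
    right
    push_cast at hmk ⊢
    nlinarith
  · exact sum_letterCount_deviation_le (weightB_nonneg Ψ) (sum_weightB hΨ) (by omega) hδ' b _
      fun w hw => (Finset.mem_filter.mp hw).2

/-- The entropy of entanglement is an achievable rate. -/
theorem isAchievableRate_entanglementEntropy {A B : Type} [Fintype A] [DecidableEq A] [Fintype B]
    [DecidableEq B] {Ψ : A × B → ℂ} (hΨ : IsPureState Ψ) :
    IsAchievableRate Ψ (entanglementEntropy Ψ) := by
  intro ε hε
  obtain ⟨U, lam, hU1, hU2, hY, hlam0, hlam1, hE⟩ := exists_schmidt hΨ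
  rw [hE]
  obtain ⟨r, hr0, hr⟩ := exists_pos_le_weightB Ψ
  set E := ∑ i, lam i * -Real.logb 2 (lam i) with hEdef
  set V₀ := ∑ i, lam i * (-Real.logb 2 (lam i) - E) ^ 2 with hV₀
  obtain ⟨q', hq'⟩ := exists_nat_gt (4 * E / ε)
  set q := q' + 1 with hq
  have hqE : E ≤ (q + 1) * (ε / 4) := by
    rw [div_lt_iff₀ hε] at hq'
    rw [hq]; push_cast
    nlinarith
  set δ := ε / 4 with hδ
  set δ' := r / (2 * q + 1) with hδ'
  set η := min (1 / 4) ((ε / 4) ^ 2) with hη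
  have hδ0 : 0 < δ := by positivity
  have hδ'0 : 0 < δ' := by positivity
  have hη0 : 0 < η := lt_min (by norm_num) (by positivity)
  have hηε : 2 * √η ≤ ε / 2 := by
    have : √η ≤ ε / 4 := Real.sqrt_le_iff.mpr ⟨by positivity, min_le_right _ _⟩
    linarith
  have e1 := (tendsto_const_div_atTop_nhds_zero_nat (V₀ / δ ^ 2 / η +
    Fintype.card B * (1 / δ' ^ 2))).eventually_lt_const (show (0 : ℝ) < 1 / 2 by norm_num)
  have e2 := (tendsto_const_div_atTop_nhds_zero_nat
    (Fintype.card B * (1 / δ' ^ 2))).eventually_lt_const (show 0 < ε / 2 by positivity)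
  have e3 := (tendsto_logb_succ_div (Fintype.card B) (-Real.logb 2 (η / 2))).eventually_lt_const
    (show 0 < ε / 2 by positivity)
  obtain ⟨N, hN⟩ := Filter.eventually_atTop.mp (e1.and (e2.and e3))
  set k := N + 1 with hk
  set m := q * k with hm
  have hk0 : 0 < k := Nat.succ_pos _
  have hq0 : 0 < q := Nat.succ_pos _
  have hm0 : 0 < m := Nat.mul_pos hq0 hk0
  have hkm : N ≤ m := by
    have := Nat.le_mul_of_pos_left k hq0
    omega
  obtain ⟨h1, h2, h3⟩ := hN m hkm
  have hm0' : (0 : ℝ) < m := by exact_mod_cast hm0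
  obtain ⟨M, y₀, c, V, hinj, hcount, hpos, hcb, hV, hov, hM⟩ := exists_code hΨ hU1 hU2 hY hlam0
    hlam1 hm0 hδ0 hδ'0 hη0 (min_le_left _ _) (by
      rw [← hEdef, ← hV₀]
      refine le_trans (le_of_eq ?_) h1.le
      ring)
  rw [← hEdef] at hM
  obtain ⟨a, L, Λ, hL, hΛ, hdist⟩ := exists_distillation hΨ m k y₀ hinj hcount hpos hV
    (by positivity) hov
  have hmq : (m : ℝ) = q * k := by rw [hm]; push_cast; rfl
  refine ⟨m + k, by omega, a, M, L, M, Λ, hL, hΛ, hdist.trans ?_, ?_⟩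
  · have hfail := sum_not_letterCount_le hΨ hk0 hδ'0 hr (m := m) (by
      rw [hδ', mul_div_assoc', div_le_iff₀ (by positivity)]
      push_cast
      rw [hmq]
      exact le_of_eq (by ring)) hpos hcb
    have h4 : Fintype.card B * (1 / δ' ^ 2 / (m + k : ℕ)) ≤ ε / 2 := by
      refine le_trans ?_ h2.le
      rw [mul_div_assoc]
      gcongr
      omega
    linarith
  · have hMpos : (0 : ℝ) < M := by exact_mod_cast y₀.pos
    have hlog : Real.logb 2 (η / 2) - Fintype.card B * Real.logb 2 (m + 1) + m * (E - δ) ≤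
        Real.logb 2 M := by
      refine le_trans (le_of_eq ?_) (Real.logb_le_logb_of_le (by norm_num) (by positivity) hM)
      have hx : η * (1 / 2 / ((m + 1 : ℕ) ^ Fintype.card B : ℕ)) =
          (η / 2) / ((m : ℝ) + 1) ^ Fintype.card B := by
        push_cast; ring
      rw [hx, Real.logb_mul (by positivity) (by positivity),
        Real.logb_div (x := η / 2) (by positivity) (by positivity), Real.logb_pow,
        Real.logb_rpow (by norm_num) (by norm_num)]
    rw [div_lt_iff₀ hm0'] at h3
    have hn0 : (0 : ℝ) < (m + k : ℕ) := by positivity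
    rw [gt_iff_lt, one_div, ← div_eq_inv_mul, lt_div_iff₀ hn0]
    refine lt_of_lt_of_le ?_ hlog
    have hkE : (k : ℝ) * E ≤ (m + k) * (ε / 4) := by
      have := mul_le_mul_of_nonneg_left hqE (Nat.cast_nonneg k)
      rw [hδ] at this
      rw [hmq]
      linarith
    have hk0' : (0 : ℝ) < k := by exact_mod_cast hk0
    push_cast
    rw [hδ]
    nlinarith

end Liocc

/-- The largest LIOCC entanglement distillation rate of a bipartite pure state exists and is its
entropy of entanglement. -/
theorem theorem6 {A B : Type} [Fintype A] [DecidableEq A] [Fintype B] [DecidableEq B]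
    (Ψ : A × B → ℂ) (hΨ : Liocc.IsPureState Ψ) :
    IsGreatest {R : ℝ | Liocc.IsAchievableRate Ψ R} (Liocc.entanglementEntropy Ψ) :=
  ⟨Liocc.isAchievableRate_entanglementEntropy hΨ, fun _ hR => hR.le_entanglementEntropy hΨ⟩
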